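/- Let $\hat A=\{\sum_{\nu\ge 0}P_\nu(a)\,b^\nu : P_\nu\in\mathbb C[[a]]\}$ be the $\mathbb C$-algebra with $ab-ba=b^2$ (left and right multiplications by elements of $\mathbb C[[a]]$ being $b$-adically continuous). For $\lambda\in\mathbb Q$ put $E_\lambda=\hat A/\hat A(a-\lambda b)$. A *simple pole module* is a left $\hat A$-module $E'$, free of finite rank over $\mathbb C[[b]]$, with $aE'\subset bE'$. A left $\hat A$-module $E$ is *regular* if it is contained in a simple pole module; $E^\sharp$ then denotes the smallest simple pole module containing $E$. It is *geometric* if it is regular and the roots of its Bernstein polynomial (the minimal polynomial of $-b^{-1}a$ acting on $E^\sharp/bE^\sharp$) are negative rational numbers. A *fresco* is a geometric left $\hat A$-module generated by one element. For rational $\lambda_1,\lambda_2$ with $\lambda_2-\lambda_1\in\mathbb Z$ and $\lambda_1+1\le\lambda_2+2$, let $\mathcal F(\lambda_1,\lambda_2)$ be the set of isomorphism classes of rank-2 frescos $E$ with fundamental invariants $\lambda_1,\lambda_2$, i.e. having a submodule $F\simeq E_{\lambda_1}$ with $E/F\simeq E_{\lambda_2}$. A *change of variable* is a series $\theta\in\mathbb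 C[[a]]$ with $\theta(0)=0$ and $\chi(\theta):=\theta'(0)\neq0$. Let $\Theta$ be the automorphism of $\hat A$ given by $\Theta\big(\sum_\nu P_\nu(a)b^\nu\big)=\sum_\nu P_\nu(\theta(a))\,(b\,\theta'(a))^\nu$. For a left $\hat A$-module $E$, let $\theta_*(E)$ be the same abelian group, on which $u\in\hat A$ acts as $\Theta(u)$ acts on $E$. **Proposition.** Let $\lambda_1>1$ and $\lambda_2$ be rational numbers such that $p_1:=\lambda_2-\lambda_1+1$ is a positive integer. For $S\in\mathbb C[[b]]$ with $S(0)=1$ put $$E(S)=\hat A\big/\hat A\,(a-\lambda_1b)\,S(b)^{-1}\,(a-\lambda_2b).$$ 1. For every $S$ with $S(0)=1$ the class $[E(S)]$ is in $\mathcal F(\lambda_1,\lambda_2)$, and every class in $\mathcal F(\lambda_1,\lambda_2)$ is $[E(S)]$ for some $S$ in the affine line $\mathcal G(\lambda_1,\lambda_2)=\{1+c\,b^{p_1}: c\in\mathbb C\}$. 2. There is a well-defined map $\alpha:\mathcal F(\lambda_1,\lambda_2)\to\mathbb C$ such that, for every $S$ with $S(0)=1$, $\alpha([E(S)])$ is the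 coefficient of $b^{p_1}$ in $S$. 3. $\alpha$ is a polynomial parameter: the function $S\mapsto\alpha([E(S)])$ on $\mathcal G(\lambda_1,\lambda_2)$ is polynomial. 4. $\alpha$ is quasi-invariant of weight $p_1$ under changes of variable: for every change of variable $\theta$, the set $\mathcal F(\lambda_1,\lambda_2)$ is stable by $\theta_*$ and $$\alpha(E)=\chi(\theta)^{p_1}\,\alpha(\theta_*(E))\qquad\text{for all }[E]\in\mathcal F(\lambda_1,\lambda_2).$$ Equivalently, $\alpha\big([\hat A/\hat A\,\Theta(P)]\big)=\chi(\theta)^{p_1}\,\alpha\big([\hat A/\hat A P]\big)$ whenever $[\hat A/\hat AP]\in\mathcal F(\lambda_1,\lambda_2)$. -/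

import Mathlib

noncomputable section

open PowerSeries

/-- The underlying set of the algebra `Â`: the sequence `P` stands for the series
`∑ ν, P ν (a) * b ^ ν`, where each `P ν` is a formal power series in `a`. -/
structure AHat where
  /-- The sequence of coefficients. -/
  co : ℕ → PowerSeries ℂ

namespace AHat

instance : CoeFun AHat (fun _ => ℕ → PowerSeries ℂ) := ⟨AHat.co⟩

/-- A series is the same thing as its sequence of coefficients. -/
def coEquiv : AHat ≃ (ℕ → PowerSeries ℂ) := ⟨AHat.co, AHat.mk, fun _ => rfl, fun _ => rfl⟩

instance : AddCommGroup AHat := coEquiv.addCommGroup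

theorem ext {P Q : AHat} (h : ∀ ν, P ν = Q ν) : P = Q := coEquiv.injective (funext h)

@[simp] theorem add_coe (P Q : AHat) (ν : ℕ) : (P + Q) ν = P ν + Q ν := rfl
@[simp] theorem sub_coe (P Q : AHat) (ν : ℕ) : (P - Q) ν = P ν - Q ν := rfl
@[simp] theorem zero_coe (ν : ℕ) : (0 : AHat) ν = 0 := rfl

/-- Left multiplication by `b`.  It is determined by `b * T(a) = T(a) * b - (b * T'(a)) * b`:
if `b * R = Q` then `Q 0 = 0` and `Q (m + 1) = R m - (Q m)'`. -/
def bMulCo (R : AHat) : ℕ → PowerSeries ℂ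
  | 0 => 0
  | m + 1 => R m - d⁄dX ℂ (bMulCo R m)

/-- The product `b * R`. -/
def bMul (R : AHat) : AHat := ⟨bMulCo R⟩

theorem bMul_zero (R : AHat) : bMul R 0 = 0 := rfl
theorem bMul_succ (R : AHat) (m : ℕ) : bMul R (m + 1) = R m - d⁄dX ℂ (bMul R m) := rfl

/-- `∑ ν, c ν (a) * Y ν` for a sequence `Y ν` of elements of `b ^ ν * Â = Â * b ^ ν`. -/
def series (c : ℕ → PowerSeries ℂ) (Y : ℕ → AHat) : AHat :=
  ⟨fun m => ∑ ν ∈ Finset.range (m + 1), c ν * Y ν m⟩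

instance : Mul AHat := ⟨fun P R => series P (fun ν => bMul^[ν] R)⟩
instance : One AHat := ⟨⟨fun ν => if ν = 0 then 1 else 0⟩⟩

theorem mul_def (P R : AHat) : P * R = series P (fun ν => bMul^[ν] R) := rfl
theorem series_coe (c : ℕ → PowerSeries ℂ) (Y : ℕ → AHat) (m : ℕ) :
    series c Y m = ∑ ν ∈ Finset.range (m + 1), c ν * Y ν m := rfl
theorem one_coe (ν : ℕ) : (1 : AHat) ν = if ν = 0 then 1 else 0 := rfl

/-! ### The faithful action on `ℂ⟦s⟧`: `a` is the multiplication by `s`, `b` is integration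
without constant. It is used to prove that `Â` is a ring. -/

def integ : PowerSeries ℂ →ₗ[ℂ] PowerSeries ℂ where
  toFun f := PowerSeries.mk fun n => coeff (n - 1) f / n
  map_add' f g := by ext n; simp [add_div]
  map_smul' c f := by ext n; simp [mul_div_assoc]

theorem coeff_integ_zero (f : PowerSeries ℂ) : coeff 0 (integ f) = 0 := by simp [integ]
theorem coeff_integ_succ (f : PowerSeries ℂ) (n : ℕ) :
    coeff (n + 1) (integ f) = coeff n f / (n + 1) := by simp [integ]

theorem deriv_integ (f : PowerSeries ℂ) : d⁄dX ℂ (integ f) = f := by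
  ext n
  rw [coeff_derivative, coeff_integ_succ]
  have : (n : ℂ) + 1 ≠ 0 := Nat.cast_add_one_ne_zero n
  field_simp

theorem eq_integ {f g : PowerSeries ℂ} (h0 : constantCoeff f = 0) (h : d⁄dX ℂ f = g) :
    f = integ g := by
  apply derivative.ext
  · rw [h, deriv_integ]
  · rw [h0, ← coeff_zero_eq_constantCoeff_apply, coeff_integ_zero]

theorem X_pow_dvd_integ {N : ℕ} {f : PowerSeries ℂ} (h : (X : PowerSeries ℂ) ^ N ∣ f) :
    (X : PowerSeries ℂ) ^ (N + 1) ∣ integ f := by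
  rw [X_pow_dvd_iff] at h ⊢
  intro m hm
  cases m with
  | zero => exact coeff_integ_zero f
  | succ m => rw [coeff_integ_succ, h m (by omega), zero_div]

theorem X_pow_dvd_iter (ν : ℕ) (f : PowerSeries ℂ) :
    (X : PowerSeries ℂ) ^ ν ∣ integ^[ν] f := by
  induction ν with
  | zero => simp
  | succ ν ih => rw [Function.iterate_succ_apply']; exact X_pow_dvd_integ ih

def opT (N : ℕ) (P : AHat) (f : PowerSeries ℂ) : PowerSeries ℂ :=
  ∑ ν ∈ Finset.range N, P ν * integ^[ν] f

def op (P : AHat) (f : PowerSeries ℂ) : PowerSeries ℂ :=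
  PowerSeries.mk fun n => coeff n (opT (n + 1) P f)

theorem coeff_opT {n N : ℕ} (h : n < N) (P : AHat) (f : PowerSeries ℂ) :
    coeff n (opT N P f) = coeff n (opT (n + 1) P f) := by
  unfold opT
  rw [← Finset.sum_range_add_sum_Ico _ (Nat.succ_le_of_lt h), map_add]
  conv_rhs => rw [← add_zero (coeff n _)]
  congr 1
  rw [map_sum]
  apply Finset.sum_eq_zero
  intro ν hν
  have hν' := (Finset.mem_Ico.1 hν).1
  exact X_pow_dvd_iff.1 (dvd_mul_of_dvd_right (X_pow_dvd_iter ν f) (P ν)) n (by omega)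

theorem op_congr (N : ℕ) (P : AHat) (f : PowerSeries ℂ) :
    (X : PowerSeries ℂ) ^ N ∣ op P f - opT N P f := by
  rw [X_pow_dvd_iff]
  intro n hn
  rw [map_sub, coeff_opT hn, op, coeff_mk, sub_self]

theorem eq_of_congr {f g : PowerSeries ℂ} (h : ∀ N, (X : PowerSeries ℂ) ^ N ∣ f - g) :
    f = g := by
  ext n
  have := X_pow_dvd_iff.1 (h (n + 1)) n (by omega)
  rwa [map_sub, sub_eq_zero] at this

theorem op_add (P Q : AHat) (f : PowerSeries ℂ) : op (P + Q) f = op P f + op Q f := by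
  ext n
  simp [op, opT, add_mul, Finset.sum_add_distrib]

theorem op_sub (P Q : AHat) (f : PowerSeries ℂ) : op (P - Q) f = op P f - op Q f := by
  ext n
  simp [op, opT, sub_mul, Finset.sum_sub_distrib]

theorem op_add_right (P : AHat) (f g : PowerSeries ℂ) : op P (f + g) = op P f + op P g := by
  ext n
  simp [op, opT, mul_add, Finset.sum_add_distrib]

theorem op_one (f : PowerSeries ℂ) : op 1 f = f := by
  ext n
  rw [op, coeff_mk, opT, Finset.sum_eq_single 0]
  · simp [one_coe]
  · intro ν _ h; simp [one_coe, h]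
  · simp

theorem op_bMul (R : AHat) (f : PowerSeries ℂ) : op (bMul R) f = integ (op R f) := by
  apply eq_integ
  · rw [← coeff_zero_eq_constantCoeff_apply, op, coeff_mk]
    simp [opT, bMul_zero]
  · ext n
    rw [coeff_derivative, op, coeff_mk, ← coeff_derivative, opT]
    have key : ∀ N, d⁄dX ℂ (∑ ν ∈ Finset.range (N + 1), bMul R ν * integ^[ν] f)
        = opT N R f + d⁄dX ℂ (bMul R N) * integ^[N] f := by
      intro N
      induction N with
      | zero => simp [bMul_zero, opT]
      | succ N ih =>
        rw [Finset.sum_range_succ, map_add, ih, Derivation.leibniz, opT, opT,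
          Finset.sum_range_succ, bMul_succ R N]
        rw [Function.iterate_succ_apply' integ N f, deriv_integ]
        simp only [smul_eq_mul]
        ring
    rw [key (n + 1), map_add, X_pow_dvd_iff.1 (dvd_mul_of_dvd_right
      (X_pow_dvd_iter (n + 1) f) _) n (by omega), add_zero, op, coeff_mk]

theorem op_bMul_iter (ν : ℕ) (R : AHat) (f : PowerSeries ℂ) :
    op (bMul^[ν] R) f = integ^[ν] (op R f) := by
  induction ν with
  | zero => rfl
  | succ ν ih => rw [Function.iterate_succ_apply', Function.iterate_succ_apply', op_bMul, ih]

theorem bMul_vanish {k : ℕ} {R : AHat} (h : ∀ m < k, R m = 0) : ∀ m < k + 1, bMul R m = 0 := by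
  intro m
  induction m with
  | zero => intro _; rfl
  | succ m ih => intro hm; rw [bMul_succ, h m (by omega), ih (by omega)]; simp

theorem bMul_iter_vanish (ν k : ℕ) (R : AHat) (h : ∀ m < k, R m = 0) :
    ∀ m < k + ν, (bMul^[ν] R) m = 0 := by
  induction ν with
  | zero => simpa using h
  | succ ν ih => rw [Function.iterate_succ_apply']; exact bMul_vanish ih

theorem op_series (c : ℕ → PowerSeries ℂ) (Y : ℕ → AHat) (hY : ∀ ν, ∀ m < ν, Y ν m = 0)
    (f : PowerSeries ℂ) (N : ℕ) :
    (X : PowerSeries ℂ) ^ N ∣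
      op (series c Y) f - ∑ ν ∈ Finset.range N, c ν * op (Y ν) f := by
  have h1 : opT N (series c Y) f = ∑ ν ∈ Finset.range N, c ν * opT N (Y ν) f := by
    simp only [opT, series_coe, Finset.sum_mul, Finset.mul_sum]
    rw [Finset.sum_comm' (t' := Finset.range N) (s' := fun ν => Finset.Ico ν N)]
    · apply Finset.sum_congr rfl
      intro ν hν
      have hν := Finset.mem_range.1 hν
      rw [← Finset.sum_range_add_sum_Ico _ hν.le]
      rw [Finset.sum_eq_zero (s := Finset.range ν), zero_add]
      · exact Finset.sum_congr rfl fun _ _ => by ring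
      · intro m hm
        rw [hY ν m (Finset.mem_range.1 hm)]; ring
    · intro m ν
      simp only [Finset.mem_range, Finset.mem_Ico]
      omega
  have h2 := op_congr N (series c Y) f
  rw [h1] at h2
  have h3 : (X : PowerSeries ℂ) ^ N ∣ ∑ ν ∈ Finset.range N, c ν * opT N (Y ν) f
      - ∑ ν ∈ Finset.range N, c ν * op (Y ν) f := by
    rw [← Finset.sum_sub_distrib]
    apply Finset.dvd_sum
    intro ν _
    rw [← mul_sub]
    apply dvd_mul_of_dvd_right
    rw [← neg_sub, dvd_neg]
    exact op_congr N (Y ν) f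
  have := dvd_add h2 h3
  simpa using this

theorem op_mul (P R : AHat) (f : PowerSeries ℂ) : op (P * R) f = op P (op R f) := by
  apply eq_of_congr
  intro N
  have h1 := op_series P (fun ν => bMul^[ν] R)
    (fun ν m hm => bMul_iter_vanish ν 0 R (by simp) m (by omega)) f N
  have h2 := op_congr N P (op R f)
  simp only [op_bMul_iter] at h1
  have := dvd_sub h1 h2
  rw [mul_def]
  simpa [opT] using this

theorem coeff_iter (ν n : ℕ) (f : PowerSeries ℂ) :
    coeff (n + ν) (integ^[ν] f) * ∏ i ∈ Finset.range ν, ((n : ℂ) + i + 1) = coeff n f := by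
  induction ν with
  | zero => simp
  | succ ν ih =>
    rw [Finset.prod_range_succ, Function.iterate_succ_apply', ← add_assoc, coeff_integ_succ]
    rw [← ih]
    have : (n : ℂ) + ν + 1 ≠ 0 := by exact_mod_cast Nat.succ_ne_zero (n + ν)
    push_cast
    field_simp

theorem poly_vanish (d : ℕ) (c : ℕ → ℂ)
    (h : ∀ n : ℕ, ∑ ν ∈ Finset.range (d + 1),
      c ν * ∏ i ∈ Finset.Ico ν d, ((n : ℂ) + i + 1) = 0) :
    ∀ k, k ≤ d → c k = 0 := by
  let p : Polynomial ℂ := ∑ ν ∈ Finset.range (d + 1),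
      Polynomial.C (c ν) * ∏ i ∈ Finset.Ico ν d, (Polynomial.X + Polynomial.C ((i : ℂ) + 1))
  have hev : ∀ z : ℂ, p.eval z = ∑ ν ∈ Finset.range (d + 1),
      c ν * ∏ i ∈ Finset.Ico ν d, (z + i + 1) := by
    intro z
    simp [p, Polynomial.eval_finsetSum, Polynomial.eval_prod, add_assoc]
  have hp : p = 0 := by
    apply Polynomial.eq_zero_of_infinite_isRoot
    apply Set.infinite_of_injective_forall_mem (f := fun n : ℕ => (n : ℂ)) Nat.cast_injective
    intro n
    simp only [Set.mem_ofPred_eq, Polynomial.IsRoot]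
    rw [hev, h n]
  have hz : ∀ z : ℂ, ∑ ν ∈ Finset.range (d + 1),
      c ν * ∏ i ∈ Finset.Ico ν d, (z + i + 1) = 0 := by
    intro z; rw [← hev, hp, Polynomial.eval_zero]
  have main : ∀ j k, k ≤ d → d - k = j → c k = 0 := by
    intro j
    induction j using Nat.strong_induction_on with
    | _ j ih =>
      intro k hk hj
      have := hz (-((k : ℂ)))
      have := hz (-((k : ℂ) - 1 + 1))
      have h0 := hz (-(k : ℂ))
      rw [Finset.sum_eq_single k] at h0
      · rcases mul_eq_zero.1 h0 with h | h
        · exact h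
        · exfalso
          rw [Finset.prod_eq_zero_iff] at h
          obtain ⟨i, hi, h⟩ := h
          have hi := (Finset.mem_Ico.1 hi).1
          have : ((i + 1 : ℕ) : ℂ) = (k : ℂ) := by push_cast; linear_combination h
          have := Nat.cast_injective this
          omega
      · intro ν hν hne
        have hν := Finset.mem_range.1 hν
        rcases lt_or_gt_of_ne hne with hlt | hgt
        · rw [Finset.prod_eq_zero (i := k - 1), mul_zero]
          · rw [Finset.mem_Ico]; omega
          · rw [Nat.cast_sub (by omega)]; push_cast; ring
        · rw [ih (d - ν) (by omega) ν (by omega) rfl, zero_mul]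
      · intro hh; exact absurd (Finset.mem_range.2 (by omega)) hh
  intro k hk
  exact main _ k hk rfl

theorem eq_zero_of_op (Z : AHat)
    (h : ∀ n, ∃ f, (∀ k < n, coeff k f = 0) ∧ coeff n f ≠ 0 ∧ op Z f = 0) : Z = 0 := by
  have main : ∀ d i j, i + j = d → coeff i (Z j) = 0 := by
    intro d
    induction d using Nat.strong_induction_on with
    | _ d ih =>
      suffices hs : ∀ k, k ≤ d → coeff (d - k) (Z k) = 0 by
        intro i j hij
        have := hs j (by omega)
        rwa [show d - j = i by omega] at this
      apply poly_vanish d (fun k => coeff (d - k) (Z k))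
      intro n
      obtain ⟨f, hf0, hf1, hf⟩ := h n
      have hlow : ∀ ν k, k < n + ν → coeff k (integ^[ν] f) = 0 := by
        intro ν
        induction ν with
        | zero => simpa using hf0
        | succ ν ihν =>
          intro k hk
          rw [Function.iterate_succ_apply']
          cases k with
          | zero => exact coeff_integ_zero _
          | succ k => rw [coeff_integ_succ, ihν k (by omega), zero_div]
      have hc : coeff (n + d) (op Z f) = 0 := by rw [hf, map_zero]
      rw [op, coeff_mk, opT, map_sum] at hc
      have hterm : ∀ ν ∈ Finset.range (n + d + 1), coeff (n + d) (Z ν * integ^[ν] f) =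
          if ν ≤ d then coeff (d - ν) (Z ν) * coeff (n + ν) (integ^[ν] f) else 0 := by
        intro ν _
        rw [coeff_mul]
        split_ifs with hν
        · rw [Finset.sum_eq_single (d - ν, n + ν)]
          · rintro ⟨i, k⟩ hik hne
            have hik := Finset.HasAntidiagonal.mem_antidiagonal.1 hik
            simp only at hik ⊢
            by_cases hk : k < n + ν
            · rw [hlow ν k hk, mul_zero]
            · rw [ih (i + ν) _ i ν rfl, zero_mul]
              have : ¬ (k = n + ν) := by
                rintro rfl
                exact hne (by simp; omega)
              omega
          · intro hh; exact absurd (Finset.HasAntidiagonal.mem_antidiagonal.2 (by simp only; omega)) hh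
        · apply Finset.sum_eq_zero
          rintro ⟨i, k⟩ hik
          have hik := Finset.HasAntidiagonal.mem_antidiagonal.1 hik
          simp only at hik ⊢
          rw [hlow ν k (by omega), mul_zero]
      rw [Finset.sum_congr rfl hterm, ← Finset.sum_range_add_sum_Ico _
        (show d + 1 ≤ n + d + 1 by omega), Finset.sum_eq_zero (s := Finset.Ico _ _), add_zero] at hc
      · have hfin : coeff n f * ∑ ν ∈ Finset.range (d + 1),
            coeff (d - ν) (Z ν) * ∏ i ∈ Finset.Ico ν d, ((n : ℂ) + i + 1) = 0 := by
          have := congrArg (fun z => z * ∏ i ∈ Finset.range d, ((n : ℂ) + i + 1)) hc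
          simp only [zero_mul, Finset.sum_mul] at this
          rw [Finset.mul_sum, ← this]
          apply Finset.sum_congr rfl
          intro ν hν
          have hν : ν ≤ d := by have := Finset.mem_range.1 hν; omega
          rw [if_pos hν, ← Finset.prod_range_mul_prod_Ico _ hν, ← coeff_iter ν n f]
          ring
        exact (mul_eq_zero.1 hfin).resolve_left hf1
      · intro ν hν
        have := (Finset.mem_Ico.1 hν).1
        rw [if_neg (by omega)]
  refine ext fun ν => PowerSeries.ext fun i => ?_
  exact main (i + ν) i ν rfl

theorem op_inj {P Q : AHat} (h : ∀ f, op P f = op Q f) : P = Q := by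
  rw [← sub_eq_zero]
  apply eq_zero_of_op
  intro n
  refine ⟨X ^ n, fun k hk => ?_, ?_, ?_⟩
  · rw [coeff_X_pow, if_neg (by omega)]
  · rw [coeff_X_pow, if_pos rfl]; exact one_ne_zero
  · rw [op_sub, h, sub_self]

theorem op_zero (f : PowerSeries ℂ) : op 0 f = 0 := by
  ext n; simp [op, opT]

theorem op_zero_right (P : AHat) : op P 0 = 0 := by
  have := op_add_right P 0 0
  simpa using this

instance : Ring AHat :=
  { (inferInstance : AddCommGroup AHat) with
    mul := (· * ·)
    one := 1
    mul_assoc := fun P Q R => op_inj fun f => by simp only [op_mul]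
    one_mul := fun P => op_inj fun f => by rw [op_mul, op_one]
    mul_one := fun P => op_inj fun f => by rw [op_mul, op_one]
    left_distrib := fun P Q R => op_inj fun f => by simp only [op_mul, op_add, op_add_right]
    right_distrib := fun P Q R => op_inj fun f => by simp only [op_mul, op_add]
    zero_mul := fun P => op_inj fun f => by simp only [op_mul, op_zero]
    mul_zero := fun P => op_inj fun f => by simp only [op_mul, op_zero, op_zero_right] }

/-- The element `T(a)` of `Â`. -/
def ofA : PowerSeries ℂ →+* AHat where
  toFun T := ⟨fun ν => if ν = 0 then T else 0⟩
  map_one' := rfl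
  map_zero' := ext fun ν => by simp
  map_add' S T := ext fun ν => by by_cases h : ν = 0 <;> simp [h]
  map_mul' S T := ext fun ν => by
    rw [mul_def, series_coe, Finset.sum_eq_single 0]
    · by_cases h : ν = 0 <;> simp [h]
    · intro k _ hk; simp [hk]
    · simp

theorem ofA_coe (T : PowerSeries ℂ) (ν : ℕ) : ofA T ν = if ν = 0 then T else 0 := rfl

/-- The element `a` of `Â`. -/
def a : AHat := ofA X

/-- The element `b` of `Â`. -/
def b : AHat := ⟨fun ν => if ν = 1 then 1 else 0⟩

theorem b_mul (R : AHat) : b * R = bMul R := by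
  refine ext fun m => ?_
  rw [mul_def, series_coe]
  cases m with
  | zero => simp [b, bMul_zero]
  | succ m =>
    rw [Finset.sum_eq_single 1]
    · simp [b]
    · intro k _ hk; simp [b, hk]
    · simp

theorem op_ofA (T f : PowerSeries ℂ) : op (ofA T) f = T * f := by
  ext n
  rw [op, coeff_mk, opT, Finset.sum_eq_single 0]
  · simp [ofA_coe]
  · intro ν _ h; simp [ofA_coe, h]
  · simp

theorem op_b (f : PowerSeries ℂ) : op b f = integ f := by
  have := op_bMul 1 f
  rwa [← b_mul, mul_one, op_one] at this

/-- The commutation relation of `Â`. -/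
theorem a_mul_b_sub : a * b - b * a = b * b := by
  apply op_inj
  intro f
  simp only [op_sub, op_mul, a, op_ofA, op_b]
  rw [sub_eq_iff_eq_add, ← map_add]
  apply eq_integ
  · simp
  · rw [Derivation.leibniz, deriv_integ]
    simp
    ring

theorem ofA_mul_coe (T : PowerSeries ℂ) (P : AHat) (m : ℕ) : (ofA T * P) m = T * P m := by
  rw [mul_def, series_coe, Finset.sum_eq_single 0]
  · simp [ofA_coe]
  · intro k _ hk; simp [ofA_coe, hk]
  · simp

/-- The element `S(b)` of `Â`. -/
def ofB : PowerSeries ℂ →+* AHat where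
  toFun S := ⟨fun ν => C (coeff ν S)⟩
  map_one' := ext fun ν => by by_cases h : ν = 0 <;> simp [h, one_coe, coeff_one]
  map_zero' := ext fun ν => by simp
  map_add' S T := ext fun ν => by simp
  map_mul' S T := by
    have hb : ∀ (k m : ℕ), (bMul^[k] (⟨fun ν => C (coeff ν T)⟩ : AHat)) m =
        if k ≤ m then C (coeff (m - k) T) else 0 := by
      intro k
      induction k with
      | zero => intro m; simp
      | succ k ih =>
        intro m
        rw [Function.iterate_succ_apply']
        have hz : ∀ m, d⁄dX ℂ (bMul (bMul^[k] (⟨fun ν => C (coeff ν T)⟩ : AHat)) m) = 0 := by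
          intro m
          induction m with
          | zero => simp [bMul_zero]
          | succ m ihm =>
            rw [bMul_succ, ihm, ih, sub_zero]
            split_ifs <;> simp
        cases m with
        | zero => simp [bMul_zero]
        | succ m =>
          rw [bMul_succ, hz, sub_zero, ih]
          simp
    refine ext fun m => ?_
    change C (coeff m (S * T)) = _
    rw [mul_def, series_coe, coeff_mul, Finset.Nat.sum_antidiagonal_eq_sum_range_succ
      (fun i j => coeff i S * coeff j T), map_sum]
    apply Finset.sum_congr rfl
    intro k hk
    rw [hb, if_pos (by have := Finset.mem_range.1 hk; omega), map_mul]

theorem ofB_coe (S : PowerSeries ℂ) (ν : ℕ) : ofB S ν = C (coeff ν S) := rfl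

theorem ofB_X : ofB X = b := by
  refine ext fun ν => ?_
  rw [ofB_coe, coeff_X]
  by_cases h : ν = 1 <;> simp [b, h]

end AHat

/-- A change of variable: a series `θ` with `θ(0) = 0` and `χ(θ) = θ'(0) ≠ 0`. -/
structure ChangeOfVariable where
  θ : PowerSeries ℂ
  constantCoeff_eq : constantCoeff θ = 0
  coeff_one_ne : coeff 1 θ ≠ 0

namespace ChangeOfVariable
open AHat

variable (t : ChangeOfVariable)

/-- `χ(θ) = θ'(0)`. -/
def chi : ℂ := coeff 1 t.θ

/-- `β = b * θ'(a)`. -/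
def beta : AHat := b * ofA (d⁄dX ℂ t.θ)

theorem hasSubst : HasSubst t.θ := HasSubst.of_constantCoeff_zero' t.constantCoeff_eq

theorem op_beta (f : PowerSeries ℂ) : op t.beta (f.subst t.θ) = (integ f).subst t.θ := by
  rw [beta, op_mul, op_b, op_ofA]
  symm
  apply eq_integ
  · apply constantCoeff_subst_eq_zero t.constantCoeff_eq
    rw [← coeff_zero_eq_constantCoeff_apply, coeff_integ_zero]
  · rw [derivative_subst t.hasSubst, deriv_integ, mul_comm]

theorem op_beta_pow (ν : ℕ) (f : PowerSeries ℂ) :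
    op (t.beta ^ ν) (f.subst t.θ) = (integ^[ν] f).subst t.θ := by
  induction ν with
  | zero => rw [pow_zero, op_one]; rfl
  | succ ν ih => rw [pow_succ', op_mul, ih, op_beta, Function.iterate_succ_apply']

theorem beta_pow_vanish (ν : ℕ) : ∀ m < ν, (t.beta ^ ν) m = 0 := by
  induction ν with
  | zero => simp
  | succ ν ih =>
    rw [pow_succ', beta, mul_assoc, b_mul]
    apply bMul_vanish
    intro m hm
    rw [ofA_mul_coe]
    exact (congrArg _ (ih m hm)).trans (mul_zero _)

theorem op_theta (x : AHat) (f : PowerSeries ℂ) :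
    op (series (fun ν => (x ν).subst t.θ) (fun ν => t.beta ^ ν)) (f.subst t.θ) =
      (op x f).subst t.θ := by
  have hdvd : ∀ (N : ℕ) (u : PowerSeries ℂ), (X : PowerSeries ℂ) ^ N ∣ u →
      (X : PowerSeries ℂ) ^ N ∣ u.subst t.θ := by
    rintro N _ ⟨v, rfl⟩
    rw [subst_mul t.hasSubst, subst_pow t.hasSubst, subst_X t.hasSubst]
    exact dvd_mul_of_dvd_left (pow_dvd_pow_of_dvd (X_dvd_iff.2 t.constantCoeff_eq) N) _
  apply eq_of_congr
  intro N
  have h1 := op_series (fun ν => (x ν).subst t.θ) (fun ν => t.beta ^ ν) t.beta_pow_vanish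
    (f.subst t.θ) N
  have h2 := hdvd N _ (op_congr N x f)
  have h3 : (opT N x f).subst t.θ =
      ∑ ν ∈ Finset.range N, (x ν).subst t.θ * op (t.beta ^ ν) (f.subst t.θ) := by
    rw [opT, ← coe_substAlgHom t.hasSubst, map_sum, coe_substAlgHom t.hasSubst]
    apply Finset.sum_congr rfl
    intro ν _
    rw [subst_mul t.hasSubst, op_beta_pow]
  rw [subst_sub t.hasSubst, h3] at h2
  have := dvd_sub h1 h2
  simpa using this

theorem op_inj_subst {P Q : AHat} (h : ∀ f : PowerSeries ℂ, op P (f.subst t.θ) = op Q (f.subst t.θ)) :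
    P = Q := by
  apply op_inj
  intro g
  have hu : IsUnit (coeff 1 t.θ) := t.coeff_one_ne.isUnit
  obtain ⟨f, rfl⟩ : ∃ f : PowerSeries ℂ, f.subst t.θ = g := by
    refine ⟨g.subst (t.θ.substInvOfIsUnit hu), ?_⟩
    rw [subst_comp_subst_apply (HasSubst.substInvOfIsUnit _ _) t.hasSubst,
      subst_substInvOfIsUnit_left _ t.constantCoeff_eq hu]
    rw [← map_algebraMap_eq_subst_X]; simp
  exact h f

/-- The endomorphism `Θ` of the ring `Â`:
`Θ (∑ ν, P ν (a) * b ^ ν) = ∑ ν, P ν (θ(a)) * (b * θ'(a)) ^ ν`. -/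
def Theta : AHat →+* AHat where
  toFun x := series (fun ν => (x ν).subst t.θ) (fun ν => t.beta ^ ν)
  map_one' := t.op_inj_subst fun f => by rw [op_theta, op_one, op_one]
  map_mul' x y := t.op_inj_subst fun f => by
    simp only [op_mul, op_theta]
  map_zero' := t.op_inj_subst fun f => by
    rw [op_theta, op_zero, op_zero, ← coe_substAlgHom t.hasSubst, map_zero]
  map_add' x y := t.op_inj_subst fun f => by
    simp only [op_add, op_theta, subst_add t.hasSubst]

theorem Theta_ofA (T : PowerSeries ℂ) : t.Theta (ofA T) = ofA (T.subst t.θ) :=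
  t.op_inj_subst fun f => by
    change op (series _ _) _ = _
    rw [op_theta, op_ofA, op_ofA, subst_mul t.hasSubst]

theorem Theta_a : t.Theta a = ofA t.θ := by
  rw [a, Theta_ofA, subst_X t.hasSubst]

theorem Theta_b : t.Theta b = b * ofA (d⁄dX ℂ t.θ) :=
  t.op_inj_subst fun f => by
    change op (series _ _) _ = op t.beta _
    rw [op_theta, op_b, op_beta]

end ChangeOfVariable
/-! ### Left modules over `Â` -/

namespace AHat

/-- The element `a - lam * b` of `Â`. -/
def aSub (lam : ℂ) : AHat := a - ofB (C lam) * b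

/-- `E` is free of rank `n` over `ℂ⟦b⟧`. -/
def IsFreeOfRank (n : ℕ) (E : Type) [AddCommGroup E] [Module AHat E] : Prop :=
  letI : Module (PowerSeries ℂ) E := Module.compHom E ofB
  Nonempty (Module.Basis (Fin n) (PowerSeries ℂ) E)

/-- `E` is a simple pole module: free of finite rank over `ℂ⟦b⟧`, with `a E ⊆ b E`. -/
def IsSimplePole (E : Type) [AddCommGroup E] [Module AHat E] : Prop :=
  (∃ n, IsFreeOfRank n E) ∧ ∀ x : E, ∃ y : E, a • x = b • y

/-- The `Â`-linear map `i : E → E'` is the saturation `E → E^♯` of `E`: it is injective, `E'` is a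
simple pole module, and no proper submodule `N` of `E'` with `a N ⊆ b N` contains the image. -/
def IsSaturation {E E' : Type} [AddCommGroup E] [Module AHat E] [AddCommGroup E'] [Module AHat E']
    (i : E →ₗ[AHat] E') : Prop :=
  Function.Injective i ∧ IsSimplePole E' ∧
    ∀ N : Submodule AHat E', LinearMap.range i ≤ N →
      (∀ x ∈ N, ∃ y ∈ N, a • x = b • y) → N = ⊤

/-- `μ` is an eigenvalue of the endomorphism of `E' / b E'` induced by `- b⁻¹ a`, where `E'` is a
simple pole module: there is `x ∉ b E'` with `a x + μ b x ∈ b² E'`. -/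
def IsResidueEigenvalue (E' : Type) [AddCommGroup E'] [Module AHat E'] (μ : ℂ) : Prop :=
  ∃ x : E', (¬ ∃ y : E', x = b • y) ∧ ∃ y : E', aSub (-μ) • x = b • b • y

/-- `E` is geometric: it is regular (contained in a simple pole module, so that `E^♯` exists), and
the roots of its Bernstein polynomial, that is of the minimal polynomial of `- b⁻¹ a` acting on
`E^♯ / b E^♯`, are negative rational numbers. -/
def IsGeometric (E : Type) [AddCommGroup E] [Module AHat E] : Prop :=
  ∃ E' : ModuleCat.{0} AHat, ∃ i : E →ₗ[AHat] E', IsSaturation i ∧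
    ∀ μ : ℂ, IsResidueEigenvalue E' μ → ∃ q : ℚ, q < 0 ∧ μ = (q : ℂ)

/-- A fresco is a geometric monogenic module. -/
def IsFresco (E : Type) [AddCommGroup E] [Module AHat E] : Prop :=
  IsGeometric E ∧ ∃ e : E, Submodule.span AHat {e} = ⊤

/-- The rank one module `E_lam = Â / Â (a - lam b)`. -/
abbrev RankOne (lam : ℚ) : Type := AHat ⧸ Submodule.span AHat {aSub (lam : ℂ)}

/-- For `lam₂ - lam₁` an integer: `E` has rank two and fundamental invariants `lam₁, lam₂`.
There is a Jordan-Hölder sequence `0 ⊂ F ⊂ E` with `F ≃ E_lam₁`, `E / F ≃ E_lam₂`, which is the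
principal one, that is `lam₁ + 1 ≤ lam₂ + 2`. -/
def HasFundamentalInvariants (lam₁ lam₂ : ℚ) (E : Type) [AddCommGroup E] [Module AHat E] : Prop :=
  lam₁ + 1 ≤ lam₂ + 2 ∧ ∃ F : Submodule AHat E,
    Nonempty (F ≃ₗ[AHat] RankOne lam₁) ∧ Nonempty ((E ⧸ F) ≃ₗ[AHat] RankOne lam₂)

/-- Isomorphism classes of left `Â`-modules. -/
def IsoClass : Type 1 := Quotient (CategoryTheory.isIsomorphicSetoid (ModuleCat.{0} AHat))

/-- The isomorphism class of a left `Â`-module. -/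
def isoClass (E : ModuleCat.{0} AHat) : IsoClass := Quotient.mk _ E

/-- The set `𝓕(lam₁, lam₂)` of isomorphism classes of rank two frescos with fundamental
invariants `lam₁, lam₂` (for `lam₂ - lam₁` an integer). -/
def frescoClasses (lam₁ lam₂ : ℚ) : Set IsoClass :=
  {x | ∃ E : ModuleCat.{0} AHat, isoClass E = x ∧ IsFresco E ∧
    HasFundamentalInvariants lam₁ lam₂ E}

/-- The module `Â / Â (a - lam₁ b) S(b)⁻¹ (a - lam₂ b)`, for `S(0) ≠ 0`. -/
def presented (lam₁ lam₂ : ℚ) (S : PowerSeries ℂ) : ModuleCat.{0} AHat :=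
  ModuleCat.of AHat
    (AHat ⧸ Submodule.span AHat {aSub (lam₁ : ℂ) * ofB S⁻¹ * aSub (lam₂ : ℂ)})

/-- The affine space `𝓖(lam₁, lam₂)` of all `S` with `S(0) = 1` in `ℂ ⊕ ℂ b ^ p`,
where `p = lam₂ - lam₁ + 1` is a positive integer. -/
def versalBase (p : ℕ) : Set (PowerSeries ℂ) :=
  {S | constantCoeff S = 1 ∧ S ∈ Submodule.span ℂ {(1 : PowerSeries ℂ), (X : PowerSeries ℂ) ^ p}}

/-- `f` is a polynomial parameter on `𝓕(lam₁, lam₂)`: its pull back to `𝓖(lam₁, lam₂)` by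
`S ↦ [Â / Â (a - lam₁ b) S⁻¹ (a - lam₂ b)]` is a polynomial function (of the coefficients
of `S`). -/
def IsPolynomialParameter (lam₁ lam₂ : ℚ) (p : ℕ) (f : frescoClasses lam₁ lam₂ → ℂ) : Prop :=
  ∃ Q : MvPolynomial ℕ ℂ, ∀ S ∈ versalBase p, ∀ x : frescoClasses lam₁ lam₂,
    isoClass (presented lam₁ lam₂ S) = x.1 → f x = MvPolynomial.eval (fun i => coeff i S) Q

end AHat

namespace ChangeOfVariable
open AHat

/-- The map `[E] ↦ [θ_*(E)]` on isomorphism classes: `u ∈ Â` acts on `θ_*(E)`, which is `E` as an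
abelian group, as `Θ(u)` acts on `E`; so `a` acts as `θ(a)` and `b` acts as `b θ'(a)`. -/
def star (t : ChangeOfVariable) : IsoClass → IsoClass :=
  Quotient.map (ModuleCat.restrictScalars t.Theta).obj
    fun _ _ ⟨e⟩ => ⟨(ModuleCat.restrictScalars t.Theta).mapIso e⟩

end ChangeOfVariable

/-- `f : 𝓕₀ → ℂ` is quasi-invariant of weight `w` under changes of variable: `𝓕₀` is stable by all
`θ_*`, and `f(E) = χ(θ) ^ w f(θ_*(E))` for all `θ` and all `E` in `𝓕₀`.
Since `Â / I` is `θ_*` of `Â / (Â Θ(I))`, this is `f([Â / Â Θ(I)]) = χ(θ) ^ w f([Â / I])`. -/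
def IsQuasiInvariant (𝓕₀ : Set AHat.IsoClass) (f : 𝓕₀ → ℂ) (w : ℕ) : Prop :=
  ∃ h : ∀ (t : ChangeOfVariable), ∀ x ∈ 𝓕₀, t.star x ∈ 𝓕₀,
    ∀ (t : ChangeOfVariable) (x : 𝓕₀), f x = t.chi ^ w * f ⟨t.star x.1, h t x.1 x.2⟩

end

namespace AHat

open PowerSeries

/-! Right division by `a - l b` leaves a unique remainder in `ℂ⟦b⟧`, so modules presented by such
factors have explicit `b`-coordinates. All computations take place in the module on `ε, e` with `(a
- (λ₁ - 1) b) ε = 0` and `(a - λ₂ b) e = S(b) b ε` (`SatModule`). Since `(a - λ₁ b) b = b (a - (λ₁ -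
1) b)`, the annihilator of `e` is generated by `(a - λ₁ b) S⁻¹ (a - λ₂ b)`. Thus `E(S)` is the
submodule generated by `e`, the big module is its saturation, and the residue eigenvalues `-(λ₁ -
1)`, `-λ₂` are negative. Conversely, in a monogenic module with these invariants a generator can be
normalised so that its annihilator has this form (`exists_equiv_presented`).

A change of generator inside `E(S)` gives `W(b) ε + T(b) e` with `W(0) = 0` and `T(0) ≠ 0`. It
satisfies the relation of `E(S')` exactly when `T` is a constant `t` and `b W' - p W + t S = t S'`.
The operator `b d/db - p` hits every power of `b` except `b ^ p`. This makes the coefficient of `b ^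
p` a complete invariant: `equiv_presented_one_add` solves the equation, `coeff_eq_of_equiv` reads
off the obstruction.

For a change of variable, the guiding picture is `ε = s ^ (λ₁ - 2)` and `e = κ s ^ (λ₂ - 1) log s -
ε / p`, with `a` multiplication by `s`, `b` integration and `κ` proportional to `c` when `S = 1 + c
b ^ p`. Replacing `s` by `θ(s) = s u(s)` multiplies by powers of `u` and turns `log s` into `log s +
log u`; the ratio of the two powers contributes `χ ^ p`. `star_relation` carries this out with
formal series in `a` acting on `ε` and `e`, the powers and the logarithm of `u` being defined by
their differential equations. -/

/-! ### Coefficients of products and reduction modulo `b` -/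

theorem mul_coe (P R : AHat) (m : ℕ) :
    (P * R) m = ∑ ν ∈ Finset.range (m + 1), P ν * (bMul^[ν] R) m := rfl

theorem mul_coe_zero (P R : AHat) : (P * R) 0 = P 0 * R 0 := by
  simp [mul_coe]

/-- Reduction modulo the two-sided ideal generated by `b`. -/
noncomputable def modB : AHat →+* PowerSeries ℂ where
  toFun x := x 0
  map_one' := by simp [one_coe]
  map_zero' := rfl
  map_add' _ _ := rfl
  map_mul' := mul_coe_zero

theorem modB_apply (x : AHat) : modB x = x 0 := rfl

theorem modB_ofA (T : PowerSeries ℂ) : modB (ofA T) = T := by simp [modB_apply, ofA_coe]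

theorem modB_a : modB a = X := modB_ofA X

theorem modB_b : modB b = 0 := by simp [modB_apply, b]

theorem modB_ofB (S : PowerSeries ℂ) : modB (ofB S) = C (constantCoeff S) := by
  simp [modB_apply, ofB_coe]

theorem modB_aSub (l : ℂ) : modB (aSub l) = X := by
  simp [aSub, modB_a, modB_b]

theorem iter_b (ν m : ℕ) : (bMul^[ν] b) m = if m = ν + 1 then 1 else 0 := by
  induction ν generalizing m with
  | zero => simp [b]
  | succ ν ih =>
    rw [Function.iterate_succ_apply']
    induction m with
    | zero => simp [bMul_zero]
    | succ m ihm => rw [bMul_succ, ih, ihm]; split_ifs <;> simp_all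

theorem mul_b_succ (x : AHat) (m : ℕ) : (x * b) (m + 1) = x m := by
  rw [mul_coe, Finset.sum_eq_single m]
  · simp [iter_b]
  · intro ν _ h; rw [iter_b, if_neg (by omega), mul_zero]
  · simp

theorem iter_a (ν m : ℕ) :
    (bMul^[ν] a) m = if m = ν then X else if m = ν + 1 then -(ν : PowerSeries ℂ) else 0 := by
  induction ν generalizing m with
  | zero => simp [a, ofA_coe]
  | succ ν ih =>
    rw [Function.iterate_succ_apply']
    induction m with
    | zero => simp [bMul_zero]
    | succ m ihm =>
      rw [bMul_succ, ih, ihm]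
      rcases lt_trichotomy m ν with h | rfl | h
      · simp [h.ne, show m ≠ ν + 1 by omega, show m ≠ ν + 1 + 1 by omega]
      · simp [show m ≠ m + 1 + 1 by omega]
      · obtain rfl | h' := (Nat.succ_le_of_lt h).eq_or_lt
        · simp; ring
        · have h1 : m ≠ ν := by omega
          have h2 : m ≠ ν + 1 := by omega
          obtain rfl | h3 := eq_or_ne m (ν + 1 + 1)
          · simp
          · simp [h1, h2, h3]

theorem mul_a_zero (x : AHat) : (x * a) 0 = X * x 0 := by
  rw [mul_coe_zero, mul_comm]; simp [a, ofA_coe]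

theorem mul_a_succ (x : AHat) (m : ℕ) : (x * a) (m + 1) = X * x (m + 1) - (m : PowerSeries ℂ) * x m := by
  rw [mul_coe, Finset.sum_range_succ, Finset.sum_range_succ, Finset.sum_eq_zero]
  · rw [iter_a, iter_a, if_neg (by omega), if_pos rfl, if_pos rfl]; ring
  · intro ν hν
    have := Finset.mem_range.1 hν
    rw [iter_a, if_neg (by omega), if_neg (by omega), mul_zero]

theorem ofB_C (c : ℂ) : ofB (C c) = ofA (C c) := by
  refine ext fun ν => ?_
  by_cases h : ν = 0 <;> simp [ofB_coe, ofA_coe, h, coeff_C]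

theorem op_smul (P : AHat) (c : ℂ) (f : PowerSeries ℂ) : op P (c • f) = c • op P f := by
  have hi : ∀ ν, integ^[ν] (c • f) = c • integ^[ν] f := by
    intro ν
    induction ν with
    | zero => rfl
    | succ ν ih => rw [Function.iterate_succ_apply', ih, map_smul, Function.iterate_succ_apply']
  ext n
  simp only [op, coeff_mk, opT, hi, mul_smul_comm, ← Finset.smul_sum, coeff_smul]

/-- Complex constants are central in `Â`. -/
noncomputable instance : Algebra ℂ AHat :=
  RingHom.toAlgebra' (ofA.comp C) fun c x => op_inj fun f => by
    simp only [RingHom.comp_apply, op_mul, op_ofA, ← smul_eq_C_mul, op_smul]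

theorem algebraMap_eq_ofA (c : ℂ) : algebraMap ℂ AHat c = ofA (C c) := rfl

theorem algebraMap_eq_ofB (c : ℂ) : algebraMap ℂ AHat c = ofB (C c) := (ofB_C c).symm

theorem smul_coe (c : ℂ) (x : AHat) (m : ℕ) : (c • x) m = c • x m := by
  rw [Algebra.smul_def, algebraMap_eq_ofA, ofA_mul_coe, smul_eq_C_mul]

theorem ofA_smul (c : ℂ) (T : PowerSeries ℂ) : ofA (c • T) = c • ofA T := by
  rw [smul_eq_C_mul, map_mul, Algebra.smul_def, algebraMap_eq_ofA]

theorem ofB_smul (c : ℂ) (T : PowerSeries ℂ) : ofB (c • T) = c • ofB T := by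
  rw [smul_eq_C_mul, map_mul, Algebra.smul_def, algebraMap_eq_ofB]

theorem aSub_eq (l : ℂ) : aSub l = a - l • b := by
  rw [aSub, Algebra.smul_def, algebraMap_eq_ofB]

theorem mul_aSub_zero (l : ℂ) (x : AHat) : (x * aSub l) 0 = X * x 0 := by
  rw [mul_coe_zero, mul_comm, ← modB_apply (aSub l), modB_aSub]

/-- From `b ^ m a = a b ^ m - m b ^ (m + 1)`: the system for a right quotient is triangular in `m`,
and each step is a division by `X` in `ℂ⟦a⟧`. -/
theorem mul_aSub_succ (l : ℂ) (x : AHat) (m : ℕ) :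
    (x * aSub l) (m + 1) = X * x (m + 1) - (l + m) • x m := by
  rw [aSub_eq, mul_sub, mul_smul_comm, sub_coe, smul_coe, mul_a_succ, mul_b_succ, add_smul]
  have : (m : ℂ) • x m = (m : PowerSeries ℂ) * x m := by rw [smul_eq_C_mul, map_natCast]
  rw [this]
  ring

/-! ### Right division by `a - l b` -/

theorem X_mul_add_C (f : PowerSeries ℂ) :
    X * (PowerSeries.mk fun n => coeff (n + 1) f) + C (coeff 0 f) = f := by
  conv_rhs => rw [eq_X_mul_shift_add_const f]
  simp

/-- The quotient of the right division by `a - l b`. -/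
noncomputable def divCo (l : ℂ) (x : AHat) : ℕ → PowerSeries ℂ
  | 0 => PowerSeries.mk fun n => coeff (n + 1) (x 0)
  | m + 1 => PowerSeries.mk fun n => coeff (n + 1) (x (m + 1) + (l + m) • divCo l x m)

/-- Right division by `a - l b`, with remainder in `ℂ⟦b⟧`. -/
theorem exists_division (l : ℂ) (x : AHat) : ∃ q T, x = q * aSub l + ofB T := by
  refine ⟨⟨divCo l x⟩, PowerSeries.mk fun m => Nat.rec (coeff 0 (x 0))
    (fun m _ => coeff 0 (x (m + 1) + (l + m) • divCo l x m)) m, ext fun m => ?_⟩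
  rw [add_coe, ofB_coe, coeff_mk]
  cases m with
  | zero => rw [mul_aSub_zero]; exact (X_mul_add_C _).symm
  | succ m =>
    rw [mul_aSub_succ]
    have := X_mul_add_C (x (m + 1) + (l + m) • divCo l x m)
    simp only [divCo]
    linear_combination -this

theorem X_mul_add_C_eq_zero {f : PowerSeries ℂ} {c : ℂ} (h : X * f + C c = 0) :
    f = 0 ∧ c = 0 := by
  have hc : c = 0 := by simpa using congrArg constantCoeff h
  subst hc
  simpa using h

/-- With `exists_division`, this identifies `Â / Â (a - l b)` with `ℂ⟦b⟧`. -/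
theorem division_unique {l : ℂ} {q : AHat} {T : PowerSeries ℂ} (h : q * aSub l + ofB T = 0) :
    q = 0 ∧ T = 0 := by
  have hm : ∀ m, q m = 0 ∧ coeff m T = 0 := by
    intro m
    have := congrArg (fun x => AHat.co x m) h
    simp only [add_coe, ofB_coe, zero_coe] at this
    induction m with
    | zero => rw [mul_aSub_zero] at this; exact X_mul_add_C_eq_zero this
    | succ m ih =>
      rw [mul_aSub_succ, (ih (by have := congrArg (fun x => AHat.co x m) h; simpa [ofB_coe] using this)).1,
        smul_zero, sub_zero] at this
      exact X_mul_add_C_eq_zero this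
  exact ⟨ext fun m => (hm m).1, PowerSeries.ext fun m => by simpa using (hm m).2⟩

theorem mul_aSub_cancel {l : ℂ} {x y : AHat} (h : x * aSub l = y * aSub l) : x = y := by
  have : (x - y) * aSub l + ofB 0 = 0 := by rw [sub_mul, h, map_zero]; simp
  exact sub_eq_zero.1 (division_unique this).1

theorem eq_zero_of_ofB_mem {l : ℂ} {T : PowerSeries ℂ} (h : ofB T ∈ Submodule.span AHat {aSub l}) :
    T = 0 := by
  obtain ⟨q, hq⟩ := Submodule.mem_span_singleton.1 h
  have : (-q) * aSub l + ofB T = 0 := by rw [← hq, smul_eq_mul]; noncomm_ring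
  exact (division_unique this).2

/-! ### Units of `Â` -/

theorem mul_vanish {k l : ℕ} {x y : AHat} (hx : ∀ m < k, x m = 0) (hy : ∀ m < l, y m = 0) :
    ∀ m < k + l, (x * y) m = 0 := by
  intro m hm
  rw [mul_coe]
  apply Finset.sum_eq_zero
  intro ν _
  by_cases h : ν < k
  · rw [hx ν h, zero_mul]
  · rw [bMul_iter_vanish ν l y hy m (by omega), mul_zero]

theorem mul_coe_congr {x x' : AHat} {m : ℕ} (h : ∀ ν ≤ m, x ν = x' ν) (y : AHat) :
    (x * y) m = (x' * y) m := by
  rw [mul_coe, mul_coe]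
  exact Finset.sum_congr rfl fun ν hν => by rw [h ν (by have := Finset.mem_range.1 hν; omega)]

theorem exists_left_inverse (x : AHat) (h : constantCoeff (modB x) ≠ 0) : ∃ y, y * x = 1 := by
  -- Normalised to be `1` modulo `b`, the element is inverted by a geometric series: `z ^ n` has no
  -- coefficient below `n`, so each coefficient of `∑ z ^ n` is a finite sum.
  obtain ⟨z, hz⟩ : ∃ z, z = 1 - ofA (modB x)⁻¹ * x := ⟨_, rfl⟩
  have hz0 : z 0 = 0 := by
    rw [← modB_apply, hz, map_sub, map_mul, modB_ofA, map_one, PowerSeries.inv_mul_cancel _ h,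
      sub_self]
  have hzn : ∀ n, ∀ m < n, (z ^ n) m = 0 := by
    intro n
    induction n with
    | zero => simp
    | succ n ih =>
      rw [pow_succ]
      exact mul_vanish ih fun m hm => by obtain rfl : m = 0 := by omega
                                         exact hz0
  have hsum : ∀ (N : ℕ) (m : ℕ), (∑ n ∈ Finset.range N, z ^ n) m =
      ∑ n ∈ Finset.range N, (z ^ n) m := by
    intro N m
    induction N with
    | zero => simp
    | succ N ih => rw [Finset.sum_range_succ, Finset.sum_range_succ, add_coe, ih]
  have hinv : (⟨fun m => ∑ n ∈ Finset.range (m + 1), (z ^ n) m⟩ : AHat) * (1 - z) = 1 := by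
    refine ext fun m => ?_
    rw [mul_coe_congr (x' := ∑ n ∈ Finset.range (m + 1), z ^ n), geom_sum_mul_neg, sub_coe,
      hzn (m + 1) m (by omega), sub_zero]
    intro ν hν
    rw [hsum]
    apply Finset.sum_subset (Finset.range_mono (by omega))
    intro n _ hn
    exact hzn n ν (by have := Finset.mem_range.not.1 hn; omega)
  exact ⟨_ * ofA (modB x)⁻¹, by rw [mul_assoc, ← hinv, hz, sub_sub_cancel]⟩

/-- An element of `Â` whose constant term is nonzero is invertible. -/
theorem isUnit_of_constantCoeff (x : AHat) (h : constantCoeff (modB x) ≠ 0) : IsUnit x := by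
  obtain ⟨y, hy⟩ := exists_left_inverse x h
  have hy0 : constantCoeff (modB y) ≠ 0 := by
    intro h0
    have := congrArg (fun w => constantCoeff (modB w)) hy
    simp [h0] at this
  obtain ⟨w, hw⟩ := exists_left_inverse y hy0
  have : w = x := left_inv_eq_right_inv hw hy
  exact ⟨⟨x, y, this ▸ hw, hy⟩, rfl⟩

/-! ### Commutation rules with series in `b` and in `a` -/

theorem a_mul_ofB (T : PowerSeries ℂ) : a * ofB T = ofB T * a + ofB (X ^ 2 * d⁄dX ℂ T) := by
  refine ext fun m => ?_
  rw [a, ofA_mul_coe, ← a, add_coe]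
  simp only [ofB_coe]
  cases m with
  | zero => simp [mul_a_zero, ofB_coe]
  | succ m =>
    rw [mul_a_succ]
    simp only [ofB_coe]
    have : coeff (m + 1) (X ^ 2 * d⁄dX ℂ T) = m * coeff m T := by
      rw [pow_two, mul_assoc, coeff_succ_X_mul]
      cases m with
      | zero => simp
      | succ m => rw [coeff_succ_X_mul, coeff_derivative]; push_cast; ring
    rw [this, map_mul, map_natCast]
    ring

theorem aSub_mul_ofB (l : ℂ) (T : PowerSeries ℂ) :
    aSub l * ofB T = ofB T * aSub l + ofB (X ^ 2 * d⁄dX ℂ T) := by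
  have : b * ofB T = ofB T * b := by rw [← ofB_X, ← map_mul, ← map_mul, mul_comm]
  rw [aSub_eq, sub_mul, mul_sub, a_mul_ofB, smul_mul_assoc, mul_smul_comm, this]
  abel

/-- Moving `b` across shifts the parameter by one; hence the parameter `l₁ - 1` for `ε` when `b ε`
carries `l₁`. -/
theorem aSub_mul_b (l : ℂ) : aSub l * b = b * aSub (l - 1) := by
  have := aSub_mul_ofB l X
  rw [ofB_X] at this
  rw [this, aSub_eq, aSub_eq, mul_sub, mul_sub, mul_smul_comm, mul_smul_comm]
  simp [pow_two, ofB_X, sub_smul]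
  abel

theorem ofA_mul_b (T : PowerSeries ℂ) : ofA T * b = b * (ofA T + ofA (d⁄dX ℂ T) * b) := by
  have h : ∀ m, bMul (ofA T + ofA (d⁄dX ℂ T) * b) m = if m = 1 then T else 0 := by
    intro m
    induction m with
    | zero => simp [bMul_zero]
    | succ m ih =>
      rw [bMul_succ, ih, add_coe, ofA_mul_coe]
      simp only [ofA_coe, b]
      rcases m with _ | _ | m <;> simp
  refine ext fun m => ?_
  rw [b_mul, h, ofA_mul_coe]
  simp only [b]
  split_ifs <;> simp

theorem aSub_add_smul (l m : ℂ) : aSub l = aSub m + (m - l) • b := by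
  rw [aSub_eq, aSub_eq, sub_smul]; abel

theorem ofB_mul_b (T : PowerSeries ℂ) : ofB T * b = ofB (X * T) := by
  rw [mul_comm X, map_mul, ofB_X]

theorem b_mul_ofB (T : PowerSeries ℂ) : b * ofB T = ofB (X * T) := by
  rw [map_mul, ofB_X]

theorem aSub_mul_ofB' (l m : ℂ) (T : PowerSeries ℂ) :
    aSub l * ofB T = ofB T * aSub m + ofB (X ^ 2 * d⁄dX ℂ T + (m - l) • (X * T)) := by
  rw [aSub_mul_ofB, aSub_add_smul l m, mul_add, mul_smul_comm, ofB_mul_b, map_add, ofB_smul]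
  abel

/-- If `q b` is right divisible by `a - (l - 1) b` then `q` is right divisible by `a - l b`. -/
theorem mem_of_mul_b_mem {l : ℂ} {q : AHat}
    (h : q * b ∈ Submodule.span AHat {aSub (l - 1)}) : q ∈ Submodule.span AHat {aSub l} := by
  obtain ⟨r, T, rfl⟩ := exists_division l q
  have h2 : ofB (X * T) ∈ Submodule.span AHat {aSub (l - 1)} := by
    rw [add_mul, mul_assoc, aSub_mul_b, ← mul_assoc, ofB_mul_b] at h
    exact (Submodule.add_mem_iff_right _ (Submodule.mem_span_singleton.2 ⟨r * b, rfl⟩)).1 h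
  have hT : T = 0 := by simpa using eq_zero_of_ofB_mem h2
  rw [hT, map_zero, add_zero]
  exact Submodule.mem_span_singleton.2 ⟨r, rfl⟩

/-! ### The ideal defining `E(S)` -/

theorem ofB_mul_inv {S : PowerSeries ℂ} (h : constantCoeff S ≠ 0) : ofB S * ofB S⁻¹ = 1 := by
  rw [← map_mul, PowerSeries.mul_inv_cancel _ h, map_one]

theorem ofB_inv_mul {S : PowerSeries ℂ} (h : constantCoeff S ≠ 0) : ofB S⁻¹ * ofB S = 1 := by
  rw [← map_mul, PowerSeries.inv_mul_cancel _ h, map_one]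

theorem mul_mem_span_iff {P : AHat} {x U V : AHat} (hUV : U * V = 1) (hVU : V * U = 1) :
    x * U ∈ Submodule.span AHat {P} ↔ x ∈ Submodule.span AHat {P * V} := by
  simp only [Submodule.mem_span_singleton, smul_eq_mul]
  constructor
  · rintro ⟨r, hr⟩; exact ⟨r, by rw [← mul_assoc, hr, mul_assoc, hUV, mul_one]⟩
  · rintro ⟨r, rfl⟩; exact ⟨r, by rw [mul_assoc, mul_assoc, hVU, mul_one]⟩

/-- The generator `(a - l₁ b) S(b)⁻¹ (a - l₂ b)` of the ideal defining a rank two fresco. -/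
noncomputable def presentation (l₁ l₂ : ℂ) (S : PowerSeries ℂ) : AHat :=
  aSub l₁ * ofB S⁻¹ * aSub l₂

theorem modB_presentation (l₁ l₂ : ℂ) (S : PowerSeries ℂ) (h : constantCoeff S = 1) :
    modB (presentation l₁ l₂ S) = X ^ 2 := by
  have : constantCoeff S⁻¹ = 1 := by rw [constantCoeff_inv, h, inv_one]
  rw [presentation, map_mul, map_mul, modB_aSub, modB_aSub, modB_ofB, this, map_one]
  ring

/-- Right cancellation of `a - l₂ b`: in `E(S)` the element `S⁻¹ (a - l₂ b) e` has annihilator `Â (a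
- l₁ b)`. -/
theorem mul_aSub_mem_presentation {l₁ l₂ : ℂ} {S : PowerSeries ℂ} (h : constantCoeff S ≠ 0)
    (q : AHat) : q * aSub l₂ ∈ Submodule.span AHat {presentation l₁ l₂ S} ↔
      q * ofB S ∈ Submodule.span AHat {aSub l₁} := by
  rw [mul_mem_span_iff (ofB_mul_inv h) (ofB_inv_mul h)]
  simp only [Submodule.mem_span_singleton, smul_eq_mul, presentation]
  constructor
  · rintro ⟨r, hr⟩; exact ⟨r, mul_aSub_cancel (l := l₂) (by rw [← hr, mul_assoc, mul_assoc])⟩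
  · rintro ⟨r, rfl⟩; exact ⟨r, by simp only [mul_assoc]⟩

/-! ### The saturation of `E(S)` in coordinates -/

/-- The module with generators `ε, e` and relations `(a - (l₁ - 1) b) ε = 0` and
`(a - l₂ b) e = S(b) b ε`. -/
abbrev SatModule (l₁ l₂ : ℂ) (S : PowerSeries ℂ) : Type :=
  (AHat × AHat) ⧸ Submodule.span AHat {((aSub (l₁ - 1), 0) : AHat × AHat),
    ((-(ofB S * b), aSub l₂) : AHat × AHat)}

namespace SatModule

variable (l₁ l₂ : ℂ) (S : PowerSeries ℂ)

/-- The first generator. -/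
noncomputable def eps : SatModule l₁ l₂ S := Submodule.Quotient.mk (1, 0)

/-- The second generator. -/
noncomputable def gen : SatModule l₁ l₂ S := Submodule.Quotient.mk (0, 1)

theorem mk_eq (x y : AHat) : (Submodule.Quotient.mk (x, y) : SatModule l₁ l₂ S) =
    x • eps l₁ l₂ S + y • gen l₁ l₂ S := by
  rw [eps, gen, ← Submodule.Quotient.mk_smul, ← Submodule.Quotient.mk_smul,
    ← Submodule.Quotient.mk_add]
  simp

theorem smul_add_smul_eq_zero {x y : AHat} : x • eps l₁ l₂ S + y • gen l₁ l₂ S = 0 ↔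
    ∃ q r : AHat, q * aSub (l₁ - 1) - r * (ofB S * b) = x ∧ r * aSub l₂ = y := by
  rw [← mk_eq, Submodule.Quotient.mk_eq_zero, Submodule.mem_span_pair]
  simp [Prod.ext_iff, sub_eq_add_neg]

theorem aSub_smul_eps : aSub (l₁ - 1) • eps l₁ l₂ S = 0 := by
  have := (smul_add_smul_eq_zero l₁ l₂ S (x := aSub (l₁ - 1)) (y := 0)).2 ⟨1, 0, by simp, by simp⟩
  simpa using this

theorem aSub_smul_gen : aSub l₂ • gen l₁ l₂ S = ofB (X * S) • eps l₁ l₂ S := by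
  have := (smul_add_smul_eq_zero l₁ l₂ S (x := -(ofB S * b)) (y := aSub l₂)).2
    ⟨0, 1, by simp, by simp⟩
  rw [neg_smul, neg_add_eq_zero] at this
  exact this.symm.trans (congrArg (· • eps l₁ l₂ S) (ofB_mul_b S))

theorem aSub_smul_coords (l : ℂ) (W T : PowerSeries ℂ) :
    aSub l • (ofB W • eps l₁ l₂ S + ofB T • gen l₁ l₂ S) =
      ofB (X ^ 2 * d⁄dX ℂ W + (l₁ - 1 - l) • (X * W) + X * (S * T)) • eps l₁ l₂ S +
      ofB (X ^ 2 * d⁄dX ℂ T + (l₂ - l) • (X * T)) • gen l₁ l₂ S := by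
  rw [smul_add, smul_smul, smul_smul, aSub_mul_ofB' l (l₁ - 1) W, aSub_mul_ofB' l l₂ T, add_smul,
    add_smul, mul_smul, mul_smul, aSub_smul_eps, aSub_smul_gen, smul_zero, zero_add, smul_smul,
    ← map_mul, map_add ofB _ (X * (S * T)), add_smul, show T * (X * S) = X * (S * T) by ring]
  abel

theorem exists_coords (z : SatModule l₁ l₂ S) :
    ∃ W T, z = ofB W • eps l₁ l₂ S + ofB T • gen l₁ l₂ S := by
  obtain ⟨⟨x, y⟩, rfl⟩ := Submodule.Quotient.mk_surjective _ z
  obtain ⟨q, T, rfl⟩ := exists_division l₂ y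
  obtain ⟨r, W, h⟩ := exists_division (l₁ - 1) (x + q * ofB (X * S))
  refine ⟨W, T, ?_⟩
  rw [mk_eq, add_smul (q * aSub l₂), mul_smul, aSub_smul_gen, smul_smul, ← add_assoc, ← add_smul, h,
    add_smul, mul_smul, aSub_smul_eps, smul_zero, zero_add]

variable {l₁ l₂ S}

/-- The relations are triangular: uniqueness of division by `a - l₂ b` kills the `e`-part, then
division by `a - (l₁ - 1) b` kills the `ε`-part. -/
theorem coords_eq_zero {W T : PowerSeries ℂ}
    (h : ofB W • eps l₁ l₂ S + ofB T • gen l₁ l₂ S = 0) : W = 0 ∧ T = 0 := by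
  obtain ⟨q, r, h1, h2⟩ := (smul_add_smul_eq_zero l₁ l₂ S).1 h
  have hr : (-r) * aSub l₂ + ofB T = 0 := by rw [← h2]; noncomm_ring
  obtain ⟨hr, hT⟩ := division_unique hr
  rw [neg_eq_zero.1 hr, zero_mul, sub_zero] at h1
  have hq : (-q) * aSub (l₁ - 1) + ofB W = 0 := by rw [← h1]; noncomm_ring
  exact ⟨(division_unique hq).2, hT⟩

theorem coords_ext {W T W' T' : PowerSeries ℂ}
    (h : ofB W • eps l₁ l₂ S + ofB T • gen l₁ l₂ S =
      ofB W' • eps l₁ l₂ S + ofB T' • gen l₁ l₂ S) : W = W' ∧ T = T' := by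
  have := coords_eq_zero (l₁ := l₁) (l₂ := l₂) (S := S) (W := W - W') (T := T - T') (by
    rw [map_sub, map_sub, sub_smul, sub_smul, sub_add_sub_comm, h, sub_self])
  exact ⟨sub_eq_zero.1 this.1, sub_eq_zero.1 this.2⟩

theorem b_smul_coords (W T : PowerSeries ℂ) :
    b • (ofB W • eps l₁ l₂ S + ofB T • gen l₁ l₂ S) =
      ofB (X * W) • eps l₁ l₂ S + ofB (X * T) • gen l₁ l₂ S := by
  rw [smul_add, smul_smul, smul_smul, b_mul_ofB, b_mul_ofB]

/-- A relation on `e` alone is `x = r (a - l₂ b)` with `r S b` divisible by `a - (l₁ - 1) b`;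
cancelling `b` makes `r S` divisible by `a - l₁ b`. -/
theorem smul_gen_eq_zero (hS : constantCoeff S ≠ 0) (x : AHat) :
    x • gen l₁ l₂ S = 0 ↔ x ∈ Submodule.span AHat {presentation l₁ l₂ S} := by
  constructor
  · intro h
    obtain ⟨q, r, h1, rfl⟩ := (smul_add_smul_eq_zero l₁ l₂ S (x := 0)).1 (by simpa using h)
    rw [mul_aSub_mem_presentation hS]
    apply mem_of_mul_b_mem
    rw [sub_eq_zero, ← mul_assoc] at h1
    exact Submodule.mem_span_singleton.2 ⟨q, h1⟩
  · intro h
    obtain ⟨r, rfl⟩ := Submodule.mem_span_singleton.1 h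
    rw [smul_eq_mul, presentation, mul_smul, mul_smul, mul_smul, aSub_smul_gen, smul_smul (ofB S⁻¹),
      ← map_mul, show S⁻¹ * (X * S) = X * (S⁻¹ * S) by ring, PowerSeries.inv_mul_cancel _ hS,
      mul_one, ofB_X, smul_smul (aSub l₁), aSub_mul_b, mul_smul b, aSub_smul_eps, smul_zero, smul_zero]

theorem isFreeOfRank : IsFreeOfRank 2 (SatModule l₁ l₂ S) := by
  unfold IsFreeOfRank
  let _ : Module (PowerSeries ℂ) (SatModule l₁ l₂ S) := Module.compHom _ ofB
  have hsmul : ∀ (T : PowerSeries ℂ) (z : SatModule l₁ l₂ S), T • z = ofB T • z := fun _ _ => rfl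
  refine ⟨Module.Basis.mk (v := ![eps l₁ l₂ S, gen l₁ l₂ S]) ?_ ?_⟩
  · rw [LinearIndependent.pair_iff]
    intro W T h
    exact coords_eq_zero h
  · intro z _
    obtain ⟨W, T, rfl⟩ := exists_coords _ _ _ z
    rw [Matrix.range_cons_cons_empty, Submodule.mem_span_pair]
    exact ⟨W, T, rfl⟩

theorem exists_aSub_smul (l : ℂ) (z : SatModule l₁ l₂ S) : ∃ y, aSub l • z = b • y := by
  obtain ⟨W, T, rfl⟩ := exists_coords _ _ _ z
  refine ⟨ofB (X * d⁄dX ℂ W + (l₁ - 1 - l) • W + S * T) • eps l₁ l₂ S +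
    ofB (X * d⁄dX ℂ T + (l₂ - l) • T) • gen l₁ l₂ S, ?_⟩
  rw [aSub_smul_coords, b_smul_coords]
  congr 3 <;> (rw [smul_eq_C_mul, smul_eq_C_mul]; ring)

theorem aSub_zero : aSub 0 = a := by simp [aSub_eq]

theorem isSimplePole : IsSimplePole (SatModule l₁ l₂ S) :=
  ⟨⟨2, isFreeOfRank⟩, fun x => aSub_zero ▸ exists_aSub_smul 0 x⟩

theorem b_smul_cancel {y z : SatModule l₁ l₂ S} (h : b • y = b • z) : y = z := by
  obtain ⟨W, T, rfl⟩ := exists_coords _ _ _ y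
  obtain ⟨W', T', rfl⟩ := exists_coords _ _ _ z
  rw [b_smul_coords, b_smul_coords] at h
  obtain ⟨h1, h2⟩ := coords_ext h
  rw [mul_left_cancel₀ X_ne_zero h1, mul_left_cancel₀ X_ne_zero h2]

/-- In the basis `ε, e` the endomorphism induced by `-b⁻¹ a` modulo `b` is triangular with these
diagonal entries; the coefficients of `b` express this. -/
theorem residueEigenvalue {μ : ℂ} (h : IsResidueEigenvalue (SatModule l₁ l₂ S) μ) :
    μ = -(l₁ - 1) ∨ μ = -l₂ := by
  obtain ⟨x, hx, y, hy⟩ := h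
  obtain ⟨W, T, rfl⟩ := exists_coords _ _ _ x
  obtain ⟨W', T', rfl⟩ := exists_coords _ _ _ y
  rw [aSub_smul_coords, b_smul_coords, b_smul_coords] at hy
  obtain ⟨h1, h2⟩ := coords_ext hy
  have h1 := congrArg (coeff 1) h1
  have h2 := congrArg (coeff 1) h2
  simp [pow_two, mul_assoc, coeff_succ_X_mul, coeff_zero_X_mul] at h1 h2
  by_contra hne
  push Not at hne
  have hT : constantCoeff T = 0 :=
    h2.resolve_left fun h0 => hne.2 (by linear_combination h0)
  rw [hT, mul_zero, add_zero] at h1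
  have hW : constantCoeff W = 0 :=
    (mul_eq_zero.1 h1).resolve_left fun h0 => hne.1 (by linear_combination h0)
  obtain ⟨W₁, rfl⟩ := X_dvd_iff.2 hW
  obtain ⟨T₁, rfl⟩ := X_dvd_iff.2 hT
  exact hx ⟨_, (b_smul_coords W₁ T₁).symm⟩

/-- Stability under `b⁻¹ a` puts `b⁻¹ a e = l₂ e + S ε` in `N`, and `S` is invertible, so `ε` lies
in `N`. -/
theorem span_gen_minimal (hS : constantCoeff S ≠ 0) (N : Submodule AHat (SatModule l₁ l₂ S))
    (hN : gen l₁ l₂ S ∈ N) (h : ∀ x ∈ N, ∃ y ∈ N, a • x = b • y) : N = ⊤ := by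
  obtain ⟨y, hy, hab⟩ := h _ hN
  have h1 : a = aSub l₂ + l₂ • b := by rw [aSub_eq]; abel
  have h2 : y = ofB S • eps l₁ l₂ S + ofB (C l₂) • gen l₁ l₂ S := by
    apply b_smul_cancel
    rw [← hab, h1, add_smul, aSub_smul_gen, b_smul_coords, mul_comm X (C l₂),
      ← smul_eq_C_mul, ofB_smul, ofB_X]
  have h3 : ofB S • eps l₁ l₂ S ∈ N := by
    rw [h2] at hy
    exact (Submodule.add_mem_iff_left _ (N.smul_mem _ hN)).1 hy
  have h4 : eps l₁ l₂ S ∈ N := by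
    have := N.smul_mem (ofB S⁻¹) h3
    rwa [smul_smul, ofB_inv_mul hS, one_smul] at this
  rw [eq_top_iff]
  intro z _
  obtain ⟨W, T, rfl⟩ := exists_coords _ _ _ z
  exact N.add_mem (N.smul_mem _ h4) (N.smul_mem _ hN)

end SatModule

/-! ### Cyclic modules, and the modules `E(S)` as frescos -/

theorem nonempty_equiv_of_generator {E : Type*} [AddCommGroup E] [Module AHat E]
    {I : Submodule AHat AHat} (y : E) (hgen : ∀ z : E, ∃ x : AHat, x • y = z)
    (hann : ∀ x : AHat, x • y = 0 ↔ x ∈ I) : Nonempty ((AHat ⧸ I) ≃ₗ[AHat] E) := by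
  have hker : LinearMap.ker (LinearMap.toSpanSingleton AHat E y) = I := by
    ext x
    rw [LinearMap.mem_ker, LinearMap.toSpanSingleton_apply, hann]
  exact ⟨(Submodule.quotEquivOfEq _ _ hker.symm).trans
    (LinearMap.quotKerEquivOfSurjective _ hgen)⟩

theorem isoClass_eq_iff (E E' : ModuleCat.{0} AHat) :
    isoClass E = isoClass E' ↔ Nonempty (E ≃ₗ[AHat] E') := by
  exact (Quotient.eq (r := CategoryTheory.isIsomorphicSetoid (ModuleCat.{0} AHat))).trans
    ⟨fun ⟨f⟩ => ⟨f.toLinearEquiv⟩, fun ⟨f⟩ => ⟨f.toModuleIso⟩⟩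

/-- The class of `1` in a cyclic module. -/
noncomputable def cyclicGen (I : Submodule AHat AHat) : AHat ⧸ I := Submodule.Quotient.mk 1

theorem smul_cyclicGen (I : Submodule AHat AHat) (x : AHat) :
    x • cyclicGen I = Submodule.Quotient.mk x := by
  rw [cyclicGen, ← Submodule.Quotient.mk_smul, smul_eq_mul, mul_one]

theorem smul_cyclicGen_eq_zero (I : Submodule AHat AHat) (x : AHat) :
    x • cyclicGen I = 0 ↔ x ∈ I := by
  rw [smul_cyclicGen, Submodule.Quotient.mk_eq_zero]

theorem exists_smul_cyclicGen (I : Submodule AHat AHat) (z : AHat ⧸ I) :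
    ∃ x : AHat, x • cyclicGen I = z := by
  obtain ⟨x, rfl⟩ := Submodule.Quotient.mk_surjective _ z
  exact ⟨x, smul_cyclicGen I x⟩

section Invariants

variable {E : Type} [AddCommGroup E] [Module AHat E]

/-- A generator `e` whose annihilator is that of the generator of `E(S)` gives the invariants. -/
theorem hasFundamentalInvariants_of_generator {lam₁ lam₂ : ℚ} (hlam : lam₁ + 1 ≤ lam₂ + 2)
    {S : PowerSeries ℂ} (hS : constantCoeff S ≠ 0) (e : E) (hgen : ∀ z : E, ∃ x : AHat, x • e = z)
    (hann : ∀ x : AHat, x • e = 0 ↔ x ∈ Submodule.span AHat {presentation lam₁ lam₂ S}) :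
    HasFundamentalInvariants lam₁ lam₂ E := by
  refine ⟨hlam, Submodule.span AHat {aSub (lam₂ : ℂ) • e}, ?_, ?_⟩
  -- The generator of `F` with annihilator exactly `Â (a - λ₁ b)` is `S⁻¹ (a - λ₂ b) e`.
  · obtain ⟨f⟩ := nonempty_equiv_of_generator (I := Submodule.span AHat {aSub (lam₁ : ℂ)})
      (E := Submodule.span AHat {aSub (lam₂ : ℂ) • e})
      ⟨ofB S⁻¹ • aSub (lam₂ : ℂ) • e,
        Submodule.smul_mem _ _ (Submodule.mem_span_singleton_self _)⟩ (by
        rintro ⟨z, hz⟩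
        obtain ⟨x, rfl⟩ := Submodule.mem_span_singleton.1 hz
        refine ⟨x * ofB S, Subtype.ext ?_⟩
        simp only [SetLike.mk_smul_mk]
        rw [mul_smul, smul_smul (ofB S), ofB_mul_inv hS, one_smul]) (by
        intro x
        rw [Subtype.ext_iff]
        simp only [SetLike.mk_smul_mk, ZeroMemClass.coe_zero]
        rw [smul_smul, smul_smul, hann, mul_aSub_mem_presentation hS, mul_assoc, ofB_inv_mul hS,
          mul_one])
    exact ⟨f.symm⟩
  · obtain ⟨f⟩ := nonempty_equiv_of_generator (I := Submodule.span AHat {aSub (lam₂ : ℂ)})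
      (E := E ⧸ Submodule.span AHat {aSub (lam₂ : ℂ) • e}) (Submodule.Quotient.mk e) (by
        intro z
        obtain ⟨z, rfl⟩ := Submodule.Quotient.mk_surjective _ z
        obtain ⟨x, rfl⟩ := hgen z
        exact ⟨x, rfl⟩) (by
        intro x
        rw [← Submodule.Quotient.mk_smul, Submodule.Quotient.mk_eq_zero,
          Submodule.mem_span_singleton, Submodule.mem_span_singleton]
        constructor
        · rintro ⟨r, hr⟩
          have h0 : x - r * aSub (lam₂ : ℂ) ∈
              Submodule.span AHat {presentation (lam₁ : ℂ) lam₂ S} := by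
            rw [← hann, sub_smul, mul_smul, hr, sub_self]
          obtain ⟨q, hq⟩ := Submodule.mem_span_singleton.1 h0
          refine ⟨q * (aSub (lam₁ : ℂ) * ofB S⁻¹) + r, ?_⟩
          rw [smul_eq_mul, presentation] at hq
          rw [smul_eq_mul, add_mul, mul_assoc, hq, sub_add_cancel]
        · rintro ⟨r, rfl⟩
          exact ⟨r, by rw [smul_smul, smul_eq_mul]⟩)
    exact ⟨f.symm⟩

end Invariants

/-- The saturation map sends the cyclic generator to `e` in `SatModule`; the two inequalities make
both residue eigenvalues negative. -/
theorem isGeometric_presented {lam₁ lam₂ : ℚ} (h1 : 1 < lam₁) (h2 : 0 < lam₂)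
    {S : PowerSeries ℂ} (hS : constantCoeff S ≠ 0) :
    IsGeometric (AHat ⧸ Submodule.span AHat {presentation (lam₁ : ℂ) lam₂ S}) := by
  let i := Submodule.liftQ (Submodule.span AHat {presentation (lam₁ : ℂ) lam₂ S})
    (LinearMap.toSpanSingleton AHat _ (SatModule.gen (lam₁ : ℂ) lam₂ S)) (by
      intro x hx
      rw [LinearMap.mem_ker, LinearMap.toSpanSingleton_apply]
      exact (SatModule.smul_gen_eq_zero hS x).2 hx)
  have hi : ∀ x : AHat, i (Submodule.Quotient.mk x) = x • SatModule.gen (lam₁ : ℂ) lam₂ S :=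
    fun x => rfl
  refine ⟨ModuleCat.of AHat (SatModule lam₁ lam₂ S), i, ⟨?_, SatModule.isSimplePole, ?_⟩, ?_⟩
  · rw [injective_iff_map_eq_zero]
    intro z hz
    obtain ⟨x, rfl⟩ := Submodule.Quotient.mk_surjective _ z
    rw [hi] at hz
    rw [Submodule.Quotient.mk_eq_zero]
    exact (SatModule.smul_gen_eq_zero hS x).1 hz
  · intro N hN h
    refine SatModule.span_gen_minimal hS N (hN ⟨Submodule.Quotient.mk 1, ?_⟩) h
    exact (hi 1).trans (one_smul _ _)
  · intro μ hμ
    rcases SatModule.residueEigenvalue hμ with rfl | rfl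
    · exact ⟨-(lam₁ - 1), by linarith, by push_cast; rfl⟩
    · exact ⟨-lam₂, by linarith, by push_cast; rfl⟩

theorem presented_mem_frescoClasses {lam₁ lam₂ : ℚ} (h1 : 1 < lam₁) (h2 : lam₁ ≤ lam₂)
    {S : PowerSeries ℂ} (hS : constantCoeff S ≠ 0) :
    isoClass (presented lam₁ lam₂ S) ∈ frescoClasses lam₁ lam₂ := by
  refine ⟨_, rfl, ⟨isGeometric_presented h1 (by linarith) hS, cyclicGen _, ?_⟩,
    hasFundamentalInvariants_of_generator (by linarith) hS (cyclicGen _)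
      (exists_smul_cyclicGen _) (smul_cyclicGen_eq_zero _)⟩
  rw [eq_top_iff]
  intro z _
  exact Submodule.mem_span_singleton.2 (exists_smul_cyclicGen _ z)

/-- A monogenic module with fundamental invariants `lam₁, lam₂` is some `E(S)`. -/
theorem exists_equiv_presented {lam₁ lam₂ : ℚ} {E : Type} [AddCommGroup E] [Module AHat E]
    (hE : HasFundamentalInvariants lam₁ lam₂ E) (hm : ∃ e : E, Submodule.span AHat {e} = ⊤) :
    ∃ S : PowerSeries ℂ, constantCoeff S = 1 ∧ Nonempty (presented lam₁ lam₂ S ≃ₗ[AHat] E) := by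
  obtain ⟨-, F, ⟨f⟩, ⟨g⟩⟩ := hE
  obtain ⟨e₀, he₀⟩ := hm
  have hgen₀ : ∀ z : E, ∃ x : AHat, x • e₀ = z := fun z =>
    Submodule.mem_span_singleton.1 (he₀ ▸ Submodule.mem_top)
  -- By division every element of `E_lam` is `T(b)` times the canonical generator. If `T(0) = 0`,
  -- the ring map to `ℂ` killing `a` and `b` would contradict generation.
  have rank_one : ∀ (lam : ℚ) (y : RankOne lam), (∀ z, ∃ x : AHat, x • y = z) →
      ∃ T : PowerSeries ℂ, constantCoeff T ≠ 0 ∧ y = ofB T • cyclicGen _ := by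
    intro lam y hy
    obtain ⟨x, rfl⟩ := exists_smul_cyclicGen _ y
    obtain ⟨q, T, rfl⟩ := exists_division (lam : ℂ) x
    have hq : (q * aSub (lam : ℂ)) • cyclicGen (Submodule.span AHat {aSub (lam : ℂ)}) = 0 :=
      (smul_cyclicGen_eq_zero _ _).2 (Submodule.mem_span_singleton.2 ⟨q, rfl⟩)
    rw [add_smul, hq, zero_add] at hy ⊢
    refine ⟨T, fun h0 => ?_, rfl⟩
    obtain ⟨z, hz⟩ := hy (cyclicGen _)
    have h1 : (z * ofB T - 1) • cyclicGen (Submodule.span AHat {aSub (lam : ℂ)}) = 0 := by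
      rw [sub_smul, mul_smul, hz, one_smul, sub_self]
    rw [smul_cyclicGen_eq_zero] at h1
    obtain ⟨r, hr⟩ := Submodule.mem_span_singleton.1 h1
    have := congrArg (fun w => constantCoeff (modB w)) hr
    simp [modB_aSub, modB_ofB, h0] at this
  obtain ⟨T, hT, hT'⟩ := rank_one lam₂ (g (Submodule.Quotient.mk e₀)) (by
    intro z
    obtain ⟨y, hy⟩ := Submodule.Quotient.mk_surjective _ (g.symm z)
    obtain ⟨x, rfl⟩ := hgen₀ y
    exact ⟨x, by rw [← map_smul, ← Submodule.Quotient.mk_smul, hy, LinearEquiv.apply_symm_apply]⟩)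
  -- This generator lifts the canonical generator of `E_λ₂`, so `(a - λ₂ b) e` lies in `F` and
  -- generates it.
  obtain ⟨e, he⟩ : ∃ e, e = ofB T⁻¹ • e₀ := ⟨_, rfl⟩
  have hgen : ∀ z : E, ∃ x : AHat, x • e = z := by
    intro z
    obtain ⟨x, rfl⟩ := hgen₀ z
    exact ⟨x * ofB T, by rw [he, smul_smul, mul_assoc, ofB_mul_inv hT, mul_one]⟩
  have hmem : ∀ x : AHat, x • e ∈ F ↔ x ∈ Submodule.span AHat {aSub (lam₂ : ℂ)} := by
    intro x
    rw [← Submodule.Quotient.mk_eq_zero, ← g.map_eq_zero_iff, he, smul_smul,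
      Submodule.Quotient.mk_smul, map_smul, hT', smul_smul, mul_assoc, ofB_inv_mul hT, mul_one,
      smul_cyclicGen_eq_zero]
  obtain ⟨f₁, hf₁⟩ : ∃ f₁ : F, f₁.1 = aSub (lam₂ : ℂ) • e :=
    ⟨⟨_, (hmem _).2 (Submodule.mem_span_singleton_self _)⟩, rfl⟩
  obtain ⟨U, hU, hU'⟩ := rank_one lam₁ (f f₁) (by
    intro z
    obtain ⟨x, hx⟩ := hgen (f.symm z).1
    obtain ⟨r, rfl⟩ := Submodule.mem_span_singleton.1 ((hmem x).1 (hx ▸ (f.symm z).2))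
    refine ⟨r, ?_⟩
    rw [← map_smul, ← LinearEquiv.eq_symm_apply]
    apply Subtype.ext
    rw [← hx, SetLike.val_smul, hf₁, smul_smul, smul_eq_mul])
  have hann : ∀ x : AHat, x • e = 0 ↔ x ∈ Submodule.span AHat {presentation lam₁ lam₂ U} := by
    have key : ∀ r : AHat, (r * aSub (lam₂ : ℂ)) • e = 0 ↔
        r * aSub (lam₂ : ℂ) ∈ Submodule.span AHat {presentation (lam₁ : ℂ) lam₂ U} := by
      intro r
      rw [mul_aSub_mem_presentation hU, mul_smul, ← hf₁, ← SetLike.val_smul,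
        ZeroMemClass.coe_eq_zero, ← f.map_eq_zero_iff, map_smul, hU', smul_smul,
        smul_cyclicGen_eq_zero]
    intro x
    constructor
    · intro hx
      obtain ⟨r, rfl⟩ := Submodule.mem_span_singleton.1 ((hmem x).1 (hx ▸ F.zero_mem))
      exact (key r).1 hx
    · intro hx
      obtain ⟨r, rfl⟩ := Submodule.mem_span_singleton.1 hx
      rw [presentation, smul_eq_mul, ← mul_assoc] at hx ⊢
      exact (key _).2 hx
  -- Dividing `U` by its constant term multiplies the presentation by a nonzero scalar and keeps the
  -- ideal.
  obtain ⟨c, hc⟩ : ∃ c, c = constantCoeff U := ⟨_, rfl⟩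
  rw [← hc] at hU
  have hspan : Submodule.span AHat {presentation (lam₁ : ℂ) lam₂ U} =
      Submodule.span AHat {presentation (lam₁ : ℂ) lam₂ (c⁻¹ • U)} := by
    have h : presentation (lam₁ : ℂ) lam₂ (c⁻¹ • U) = c • presentation (lam₁ : ℂ) lam₂ U := by
      rw [presentation, presentation, PowerSeries.smul_inv, inv_inv, ofB_smul, mul_smul_comm, smul_mul_assoc]
    rw [h, ← algebraMap_smul AHat c (presentation (lam₁ : ℂ) lam₂ U)]
    refine (Submodule.span_singleton_smul_eq ?_ _).symm
    exact (IsUnit.mk0 c hU).map (algebraMap ℂ AHat)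
  refine ⟨c⁻¹ • U, by simp [← hc, hU], ?_⟩
  apply nonempty_equiv_of_generator e hgen
  rw [← presentation, ← hspan]
  exact hann

/-! ### Normal form and invariance of the coefficient of `b ^ p` -/

/-- Common criterion for recognising a cyclic module by another generator: `φ` is the identity for
the normal form, and `Θ` for `θ_*`. -/
theorem smul_unit_cyclicGen_eq_zero {φ : AHat →+* AHat} (hφ : Function.Bijective φ)
    {P P' U V : AHat} (hU : IsUnit U) (hV : IsUnit V) (h : φ P' * U = V * P) (x : AHat) :
    φ x • U • cyclicGen (Submodule.span AHat {P}) = 0 ↔ x ∈ Submodule.span AHat {P'} := by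
  rw [smul_smul, smul_cyclicGen_eq_zero, Submodule.mem_span_singleton,
    Submodule.mem_span_singleton]
  constructor
  · rintro ⟨r, hr⟩
    obtain ⟨V', hV'⟩ := hV.exists_left_inv
    obtain ⟨w, hw⟩ := hφ.2 (r * V')
    refine ⟨w, hφ.1 (hU.mul_right_cancel ?_)⟩
    rw [← hr, smul_eq_mul, smul_eq_mul, map_mul, mul_assoc, h, hw, mul_assoc, ← mul_assoc V', hV',
      one_mul]
  · rintro ⟨w, rfl⟩
    exact ⟨φ w * V, by rw [smul_eq_mul, smul_eq_mul, map_mul, mul_assoc, mul_assoc, h]⟩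

theorem exists_smul_unit_cyclicGen {φ : AHat →+* AHat} (hφ : Function.Bijective φ)
    {I : Submodule AHat AHat} {U : AHat} (hU : IsUnit U) (z : AHat ⧸ I) :
    ∃ x, φ x • U • cyclicGen I = z := by
  obtain ⟨y, rfl⟩ := exists_smul_cyclicGen _ z
  obtain ⟨U', hU'⟩ := hU.exists_left_inv
  obtain ⟨x, hx⟩ := hφ.2 (y * U')
  exact ⟨x, by rw [smul_smul, hx, mul_assoc, hU', mul_one]⟩

/-- The cofactor `V` is a unit because both presentations have order two in `a` modulo `b`:
cancelling `X ^ 2` leaves `modB V = modB v * modB U`. -/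
theorem eq_unit_mul {l₁ l₂ : ℂ} {S : PowerSeries ℂ} (hS : constantCoeff S = 1) {Q U v : AHat}
    (hQ : modB Q = modB v * X ^ 2) (hv : constantCoeff (modB v) ≠ 0)
    (hU : constantCoeff (modB U) ≠ 0)
    (h : (Q * U) • SatModule.gen l₁ l₂ S = 0) :
    ∃ V, IsUnit V ∧ Q * U = V * presentation l₁ l₂ S := by
  rw [SatModule.smul_gen_eq_zero (by simp [hS])] at h
  obtain ⟨V, hV⟩ := Submodule.mem_span_singleton.1 h
  refine ⟨V, isUnit_of_constantCoeff V ?_, hV.symm⟩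
  have h1 := congrArg modB hV
  rw [smul_eq_mul, map_mul, map_mul, modB_presentation _ _ _ hS, hQ] at h1
  have h2 : modB V = modB v * modB U :=
    mul_right_cancel₀ (pow_ne_zero 2 X_ne_zero) (h1.trans (by ring))
  rw [h2, map_mul]
  exact mul_ne_zero hv hU

/-- `b ε` lies in the submodule generated by `e`. -/
theorem SatModule.b_smul_eps {l₁ l₂ : ℂ} {S : PowerSeries ℂ} (hS : constantCoeff S ≠ 0) :
    b • SatModule.eps l₁ l₂ S = (ofB S⁻¹ * aSub l₂) • SatModule.gen l₁ l₂ S := by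
  rw [mul_smul, SatModule.aSub_smul_gen, smul_smul, ← map_mul,
    show S⁻¹ * (X * S) = X * (S⁻¹ * S) by ring, PowerSeries.inv_mul_cancel _ hS, mul_one, ofB_X]

theorem SatModule.presentation_smul_coords {l₁ l₂ : ℂ} {S : PowerSeries ℂ} (S' W T : PowerSeries ℂ) :
    presentation l₁ l₂ S' • (ofB W • SatModule.eps l₁ l₂ S + ofB T • SatModule.gen l₁ l₂ S) =
      aSub l₁ • (ofB (S'⁻¹ * (X ^ 2 * d⁄dX ℂ W + (l₁ - 1 - l₂) • (X * W) + X * (S * T))) •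
        SatModule.eps l₁ l₂ S + ofB (S'⁻¹ * (X ^ 2 * d⁄dX ℂ T)) • SatModule.gen l₁ l₂ S) := by
  rw [presentation, mul_smul, mul_smul, SatModule.aSub_smul_coords, smul_add (ofB S'⁻¹), smul_smul,
    smul_smul, ← map_mul, ← map_mul, sub_self, zero_smul, add_zero]

theorem coeff_X_mul_derivative (n : ℕ) (T : PowerSeries ℂ) :
    coeff n (X * d⁄dX ℂ T) = n * coeff n T := by
  cases n with
  | zero => simp
  | succ n => rw [coeff_succ_X_mul, coeff_derivative]; push_cast; ring

/-- Every `E(S)` is isomorphic to `E(1 + S_p b ^ p)`. -/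
theorem equiv_presented_one_add {l₁ l₂ : ℂ} {p : ℕ} (hp : 1 ≤ p) (hl : (p : ℂ) = l₂ - l₁ + 1)
    {S : PowerSeries ℂ} (hS : constantCoeff S = 1) :
    Nonempty ((AHat ⧸ Submodule.span AHat {presentation l₁ l₂ (1 + C (coeff p S) * X ^ p)}) ≃ₗ[AHat]
      (AHat ⧸ Submodule.span AHat {presentation l₁ l₂ S})) := by
  obtain ⟨S', hS'⟩ : ∃ S', S' = 1 + C (coeff p S) * X ^ p := ⟨_, rfl⟩
  have hp0 : p ≠ 0 := by omega
  have hS'0 : constantCoeff S' = 1 := by simp [hS', hp0]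
  have hS'p : coeff p S' = coeff p S := by simp [hS', coeff_one, hp0]
  -- Coefficientwise solution of `X W' - p W + S = S'`. At the resonance `n = p` the quotient is `0
  -- / 0 = 0`, which is harmless since `S` and `S'` agree there.
  obtain ⟨W, hW⟩ : ∃ W : PowerSeries ℂ, W = PowerSeries.mk fun n =>
    (coeff n S' - coeff n S) / ((n : ℂ) - p) := ⟨_, rfl⟩
  have hW0 : constantCoeff W = 0 := by
    rw [← coeff_zero_eq_constantCoeff_apply, hW, coeff_mk, coeff_zero_eq_constantCoeff_apply,
      coeff_zero_eq_constantCoeff_apply, hS'0, hS, sub_self, zero_div]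
  have hode : X * d⁄dX ℂ W + (l₁ - 1 - l₂) • W + S = S' := by
    ext n
    rw [map_add, map_add, coeff_X_mul_derivative, coeff_smul, hW, coeff_mk, smul_eq_mul,
      show l₁ - 1 - l₂ = -(p : ℂ) by rw [hl]; ring]
    by_cases hn : n = p
    · subst hn; rw [hS'p]; simp
    · have : (n : ℂ) - p ≠ 0 := sub_ne_zero.2 (by exact_mod_cast hn)
      field_simp
      ring
  -- `ε` need not lie in `E(S)` but `b ε` does, so `W(0) = 0` lets `e + W ε` be written `U e`.
  obtain ⟨W₁, rfl⟩ := X_dvd_iff.2 hW0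
  obtain ⟨U, hU⟩ : ∃ U, U = 1 + ofB W₁ * (ofB S⁻¹ * aSub l₂) := ⟨_, rfl⟩
  have hU0 : constantCoeff (modB U) ≠ 0 := by simp [hU, modB_aSub]
  have hUgen : U • SatModule.gen l₁ l₂ S =
      ofB (X * W₁) • SatModule.eps l₁ l₂ S + ofB 1 • SatModule.gen l₁ l₂ S := by
    rw [hU, add_smul, mul_smul (ofB W₁), ← SatModule.b_smul_eps (by simp [hS]),
      smul_smul (ofB W₁), ofB_mul_b W₁, map_one, add_comm]
  have hzero : (presentation l₁ l₂ S' * U) • SatModule.gen l₁ l₂ S = 0 := by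
    rw [mul_smul, hUgen, SatModule.presentation_smul_coords]
    have : S'⁻¹ * (X ^ 2 * d⁄dX ℂ (X * W₁) + (l₁ - 1 - l₂) • (X * (X * W₁)) + X * (S * 1)) = X := by
      rw [show X ^ 2 * d⁄dX ℂ (X * W₁) + (l₁ - 1 - l₂) • (X * (X * W₁)) + X * (S * 1) =
        X * (X * d⁄dX ℂ (X * W₁) + (l₁ - 1 - l₂) • (X * W₁) + S) by
          simp only [smul_eq_C_mul]; ring, hode, mul_left_comm,
        PowerSeries.inv_mul_cancel _ (by simp [hS'0]), mul_one]
    rw [this, Derivation.map_one_eq_zero]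
    simp only [mul_zero, map_zero, zero_smul, add_zero]
    rw [ofB_X, smul_smul, aSub_mul_b, mul_smul, SatModule.aSub_smul_eps, smul_zero]
  obtain ⟨V, hV, hVU⟩ := eq_unit_mul hS (v := 1)
    (by rw [modB_presentation _ _ _ hS'0]; simp) (by simp) hU0 hzero
  have hid : Function.Bijective (RingHom.id AHat) := Function.bijective_id
  have hUu := isUnit_of_constantCoeff U hU0
  rw [← hS']
  exact nonempty_equiv_of_generator (U • cyclicGen _) (exists_smul_unit_cyclicGen hid hUu)
    (smul_unit_cyclicGen_eq_zero hid hUu hV hVU)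

/-- The coefficient of `b ^ p` in `S` only depends on the isomorphism class of `E(S)`. -/
theorem coeff_eq_of_equiv {l₁ l₂ : ℂ} {p : ℕ} (hp : 1 ≤ p) (hl : (p : ℂ) = l₂ - l₁ + 1)
    {S S' : PowerSeries ℂ} (hS : constantCoeff S = 1) (hS' : constantCoeff S' = 1)
    (f : (AHat ⧸ Submodule.span AHat {presentation l₁ l₂ S'}) ≃ₗ[AHat]
      (AHat ⧸ Submodule.span AHat {presentation l₁ l₂ S})) : coeff p S = coeff p S' := by
  have hS0 : constantCoeff S ≠ 0 := by simp [hS]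
  have hS'0 : constantCoeff S' ≠ 0 := by simp [hS']
  obtain ⟨x, hx⟩ := exists_smul_cyclicGen _ (f (cyclicGen _))
  have hPx : (presentation l₁ l₂ S' * x) • SatModule.gen l₁ l₂ S = 0 := by
    rw [SatModule.smul_gen_eq_zero hS0, ← smul_cyclicGen_eq_zero, mul_smul, hx, ← map_smul,
      (smul_cyclicGen_eq_zero _ _).2 (Submodule.mem_span_singleton_self _), map_zero]
  -- The image of a generator generates, so its constant term survives the map killing `a` and `b`.
  have hx0 : constantCoeff (modB x) ≠ 0 := by
    intro h0
    obtain ⟨z, hz⟩ := exists_smul_cyclicGen _ (f.symm (cyclicGen _))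
    have h1 : (z * x - 1) • cyclicGen (Submodule.span AHat {presentation l₁ l₂ S}) = 0 := by
      rw [sub_smul, mul_smul, hx, ← map_smul, hz, f.apply_symm_apply, one_smul, sub_self]
    rw [smul_cyclicGen_eq_zero] at h1
    obtain ⟨r, hr⟩ := Submodule.mem_span_singleton.1 h1
    have := congrArg (fun w => constantCoeff (modB w)) hr
    simp [modB_presentation _ _ _ hS, h0] at this
  obtain ⟨q, T, rfl⟩ := exists_division l₂ x
  obtain ⟨r, W, hW⟩ := exists_division (l₁ - 1) (q * ofB (X * S))
  have hW0 : constantCoeff W = 0 := by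
    have := congrArg (fun w => constantCoeff (modB w)) hW
    simpa [modB_aSub, modB_ofB] using this.symm
  have hT0 : constantCoeff T ≠ 0 := by simpa [modB_aSub, modB_ofB] using hx0
  have hcoords : (q * aSub l₂ + ofB T) • SatModule.gen l₁ l₂ S =
      ofB W • SatModule.eps l₁ l₂ S + ofB T • SatModule.gen l₁ l₂ S := by
    rw [add_smul, mul_smul q, SatModule.aSub_smul_gen, smul_smul q, hW, add_smul, mul_smul r,
      SatModule.aSub_smul_eps, smul_zero, zero_add]
  rw [mul_smul, hcoords, SatModule.presentation_smul_coords, SatModule.aSub_smul_coords] at hPx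
  obtain ⟨h1, h2⟩ := SatModule.coords_eq_zero hPx
  have hl' : l₂ - l₁ = (p : ℂ) - 1 := by rw [hl]; ring
  have hl'' : l₁ - 1 - l₂ = -(p : ℂ) := by rw [hl]; ring
  rw [hl'] at h2
  -- The `e`-coordinate: `X V' + (p - 1) V` multiplies the coefficient of degree `n + 1` by `n + p ≠
  -- 0`, and `V(0) = 0`. Hence `T` is constant.
  have hV : S'⁻¹ * (X ^ 2 * d⁄dX ℂ T) = 0 := by
    have h3 : ∀ V : PowerSeries ℂ, X ^ 2 * d⁄dX ℂ V + ((p : ℂ) - 1) • (X * V) = 0 →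
        constantCoeff V = 0 → V = 0 := by
      intro V h h0
      have h' : X * (X * d⁄dX ℂ V + ((p : ℂ) - 1) • V) = 0 := by
        rw [← h, smul_eq_C_mul, smul_eq_C_mul]; ring
      have h' := (mul_eq_zero.1 h').resolve_left X_ne_zero
      ext n
      cases n with
      | zero => simpa using h0
      | succ n =>
        have := congrArg (coeff (n + 1)) h'
        rw [map_add, coeff_X_mul_derivative, coeff_smul, smul_eq_mul, map_zero, ← add_mul] at this
        refine (mul_eq_zero.1 this).resolve_left ?_
        have : ((n + p : ℕ) : ℂ) ≠ 0 := Nat.cast_ne_zero.2 (by omega)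
        push_cast at this ⊢
        intro h; apply this; linear_combination h
    exact h3 _ h2 (by simp)
  have hinv : ∀ V : PowerSeries ℂ, S'⁻¹ * V = 0 → V = 0 := fun V h => by
    rw [← one_mul V, ← PowerSeries.mul_inv_cancel _ hS'0, mul_assoc, h, mul_zero]
  have hdT : d⁄dX ℂ T = 0 :=
    (mul_eq_zero.1 (hinv _ hV)).resolve_left (pow_ne_zero 2 X_ne_zero)
  obtain ⟨t, rfl⟩ : ∃ t, T = C t :=
    ⟨constantCoeff T, derivative.ext (by simp [hdT]) (by simp)⟩
  rw [hV, mul_zero, mul_zero, add_zero] at h1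
  -- The `ε`-coordinate: `a - l₁ b` sends `X Y ε` to `X ^ 3 Y' ε`, so `Y` is constant too.
  obtain ⟨Y, hY⟩ : ∃ Y, Y = S'⁻¹ * (X * d⁄dX ℂ W + (l₁ - 1 - l₂) • W + S * C t) := ⟨_, rfl⟩
  have hXY : S'⁻¹ * (X ^ 2 * d⁄dX ℂ W + (l₁ - 1 - l₂) • (X * W) + X * (S * C t)) = X * Y := by
    rw [hY, smul_eq_C_mul, smul_eq_C_mul]; ring
  rw [hXY] at h1
  have hdY : d⁄dX ℂ Y = 0 := by
    have : X ^ 3 * d⁄dX ℂ Y = 0 := by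
      rw [← h1, Derivation.leibniz, smul_eq_C_mul]
      simp
      ring
    exact (mul_eq_zero.1 this).resolve_left (pow_ne_zero 3 X_ne_zero)
  obtain ⟨z, rfl⟩ : ∃ z, Y = C z :=
    ⟨constantCoeff Y, derivative.ext (by simp [hdY]) (by simp)⟩
  have hfin : X * d⁄dX ℂ W + (l₁ - 1 - l₂) • W + S * C t = S' * C z := by
    rw [hY, ← mul_assoc, PowerSeries.mul_inv_cancel _ hS'0, one_mul]
  have hz : t = z := by
    have := congrArg constantCoeff hfin
    simpa [hS, hS', hW0] using this
  -- In degree `p` the terms in `W` cancel: this is the obstruction that preserves the coefficient.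
  have := congrArg (coeff p) hfin
  rw [map_add, map_add, coeff_X_mul_derivative, coeff_smul, coeff_mul_C, coeff_mul_C, hl'', hz,
    smul_eq_mul, neg_mul, add_neg_cancel, zero_add] at this
  refine mul_right_cancel₀ ?_ this
  rw [← hz]
  simpa using hT0

/-! ### Series in `a` acting on elements killed by `a - l b` -/

theorem exists_exp_integ (h : PowerSeries ℂ) :
    ∃ G : PowerSeries ℂ, constantCoeff G = 1 ∧ d⁄dX ℂ G = h * G := by
  have h0 : constantCoeff (integ h) = 0 := by
    rw [← coeff_zero_eq_constantCoeff_apply, coeff_integ_zero]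
  have hs : HasSubst (integ h) := HasSubst.of_constantCoeff_zero' h0
  refine ⟨(exp ℂ).subst (integ h), ?_, ?_⟩
  · have h1 : constantCoeff ((exp ℂ - 1).subst (integ h)) = 0 :=
      constantCoeff_subst_eq_zero h0 _ (by simp)
    rw [subst_sub hs, map_sub, ← coe_substAlgHom hs, map_one, map_one, sub_eq_zero,
      coe_substAlgHom hs] at h1
    exact h1
  · rw [derivative_subst hs, deriv_integ, derivative_exp, mul_comm]

/-- Integration by parts; it moves `b` to the left through the factors produced by
`Theta_aSub_mul_ofA`. -/
theorem ofA_sub_mul_b (k : PowerSeries ℂ) :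
    (ofA k - b * ofA (d⁄dX ℂ k)) * b = b * ofA k := by
  rw [sub_mul, ofA_mul_b, mul_add, mul_assoc, add_sub_cancel_right]

/-- On an element killed by `a - l b`, as on `s ^ (l - 1)`, the power `b ^ p` becomes `a ^ p` up to
this scalar. -/
theorem exists_a_pow_eq (l : ℂ) (p : ℕ) :
    ∃ q, a ^ p = (∏ j ∈ Finset.range p, (l + j)) • b ^ p + q * aSub l := by
  induction p with
  | zero => exact ⟨0, by simp⟩
  | succ p ih =>
    obtain ⟨q, hq⟩ := ih
    have h : ∀ p : ℕ, b ^ p * a = a * b ^ p - (p : ℂ) • b ^ (p + 1) := by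
      intro p
      induction p with
      | zero => simp
      | succ p ih =>
        have hab : b * a = a * b - b * b := by rw [← a_mul_b_sub]; abel
        rw [pow_succ', mul_assoc, ih, mul_sub, ← mul_assoc, hab, sub_mul, mul_assoc, mul_assoc,
          mul_smul_comm, ← pow_succ', ← pow_succ']
        push_cast
        rw [add_smul, one_smul]
        abel
    have h' : a * b ^ p = b ^ p * aSub l + (l + p) • b ^ (p + 1) := by
      rw [aSub_eq, mul_sub, h, mul_smul_comm, ← pow_succ, add_smul]
      abel
    refine ⟨(∏ j ∈ Finset.range p, (l + j)) • b ^ p + a * q, ?_⟩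
    rw [pow_succ', hq, mul_add, mul_smul_comm, h', Finset.prod_range_succ, smul_add, smul_smul,
      add_mul, smul_mul_assoc, mul_assoc]
    abel

/-- Multiplication by `a` expressed through `b` on an element killed by `a - l b`. -/
theorem ofA_X_mul_smul {E : Type*} [AddCommGroup E] [Module AHat E] {l : ℂ} {x : E}
    (hx : aSub l • x = 0) (f : PowerSeries ℂ) :
    ofA (X * f) • x = (b * ofA (C l * f + X * d⁄dX ℂ f)) • x := by
  have h : ofA (X * f) - b * ofA (C l * f + X * d⁄dX ℂ f) =
      (ofA f - b * ofA (d⁄dX ℂ f)) * aSub l := by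
    rw [aSub_eq, mul_sub, mul_smul_comm, ofA_sub_mul_b, sub_mul, a, mul_assoc, ← map_mul, ← map_mul,
      map_add, mul_add, ← smul_eq_C_mul, ofA_smul, mul_smul_comm, mul_comm X f, mul_comm X]
    abel
  rw [← sub_eq_zero, ← sub_smul, h, mul_smul, hx, smul_zero]

end AHat

/-! ### Action of changes of variable -/

namespace ChangeOfVariable

open AHat PowerSeries

variable (t : ChangeOfVariable)

theorem modB_Theta (x : AHat) : modB (t.Theta x) = (modB x).subst t.θ := by
  have h : t.Theta x = series (fun ν => (x ν).subst t.θ) (fun ν => t.beta ^ ν) := rfl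
  rw [modB_apply, h, series_coe, zero_add, Finset.sum_range_one, pow_zero, one_coe, if_pos rfl,
    mul_one, modB_apply]

theorem Theta_smul (c : ℂ) (x : AHat) : t.Theta (c • x) = c • t.Theta x := by
  have : (C c : PowerSeries ℂ).subst t.θ = C c := by
    rw [← coe_substAlgHom t.hasSubst]
    exact (substAlgHom t.hasSubst).commutes c
  rw [Algebra.smul_def, map_mul, algebraMap_eq_ofA, Theta_ofA, this, Algebra.smul_def,
    algebraMap_eq_ofA]

theorem Theta_aSub (l : ℂ) : t.Theta (aSub l) = ofA t.θ - l • (b * ofA (d⁄dX ℂ t.θ)) := by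
  rw [aSub_eq, map_sub, Theta_smul, Theta_a, Theta_b]

/-- The inverse change of variable. -/
noncomputable def symm : ChangeOfVariable where
  θ := t.θ.substInvOfIsUnit t.coeff_one_ne.isUnit
  constantCoeff_eq := by simp
  coeff_one_ne := by
    rw [coeff_one_substInvOfIsUnit]
    exact Units.ne_zero _

theorem subst_symm_subst (f : PowerSeries ℂ) : 
    PowerSeries.subst t.θ (PowerSeries.subst t.symm.θ f) = f := by
  rw [subst_comp_subst_apply t.symm.hasSubst t.hasSubst]
  change f.subst (PowerSeries.subst t.θ (t.θ.substInvOfIsUnit t.coeff_one_ne.isUnit)) = f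
  rw [subst_substInvOfIsUnit_left _ t.constantCoeff_eq, ← map_algebraMap_eq_subst_X]
  simp

theorem subst_subst_symm (f : PowerSeries ℂ) : 
    PowerSeries.subst t.symm.θ (PowerSeries.subst t.θ f) = f := by
  rw [subst_comp_subst_apply t.hasSubst t.symm.hasSubst]
  change f.subst (PowerSeries.subst (t.θ.substInvOfIsUnit t.coeff_one_ne.isUnit) t.θ) = f
  rw [subst_substInvOfIsUnit_right _ t.constantCoeff_eq, ← map_algebraMap_eq_subst_X]
  simp

theorem op_Theta (x : AHat) (f : PowerSeries ℂ) :
    op (t.Theta x) (f.subst t.θ) = (op x f).subst t.θ := t.op_theta x f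

theorem Theta_bijective : Function.Bijective t.Theta := by
  constructor
  · intro x y h
    apply op_inj
    intro f
    rw [← t.subst_subst_symm (op x f), ← op_Theta, h, op_Theta, subst_subst_symm]
  · intro y
    refine ⟨t.symm.Theta y, op_inj fun f => ?_⟩
    rw [← t.subst_symm_subst f, op_Theta, op_Theta, subst_symm_subst, subst_symm_subst]

/-- The twisted symbol `a - l b` is, up to units, the symbol itself. -/
theorem Theta_aSub_mul_ofA {l : ℂ} {u G : PowerSeries ℂ} (hu : t.θ = X * u)
    (hG : u * d⁄dX ℂ G = C (l - 1) * (d⁄dX ℂ u * G)) :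
    t.Theta (aSub l) * ofA G = (ofA (u * G) - b * ofA (d⁄dX ℂ (u * G))) * aSub l := by
  -- With `θ' = u + X u'`, this is `X` times the equation of `G`.
  have h1 : C l * (d⁄dX ℂ t.θ * G) = d⁄dX ℂ (u * G) * X + C l * (u * G) := by
    rw [hu, Derivation.leibniz, Derivation.leibniz, derivative_X]
    simp only [smul_eq_mul]
    rw [map_sub, map_one] at hG
    linear_combination (-X) * hG
  rw [Theta_aSub, aSub_eq, mul_sub, mul_smul_comm, ofA_sub_mul_b, sub_mul, sub_mul, smul_mul_assoc,
    mul_assoc b, mul_assoc b, a, ← map_mul, ← map_mul, ← map_mul, ← map_mul, ← mul_smul_comm,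
    ← mul_smul_comm, ← ofA_smul, ← ofA_smul, smul_eq_C_mul, smul_eq_C_mul, h1, hu, map_add, mul_add,
    show X * u * G = u * G * X by ring]
  abel

theorem exists_eq_X_mul : ∃ u, t.θ = X * u ∧ constantCoeff u = t.chi := by
  obtain ⟨u, hu⟩ := X_dvd_iff.2 t.constantCoeff_eq
  refine ⟨u, hu, ?_⟩
  rw [chi, hu, coeff_succ_X_mul, coeff_zero_eq_constantCoeff_apply]

/-- The series `(θ(a) / (χ(θ) a)) ^ μ`, characterised by its differential equation. -/
theorem exists_power {u : PowerSeries ℂ} (hu : constantCoeff u ≠ 0) (μ : ℂ) :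
    ∃ G : PowerSeries ℂ, constantCoeff G = 1 ∧ u * d⁄dX ℂ G = C μ * (d⁄dX ℂ u * G) := by
  obtain ⟨G, h0, h⟩ := exists_exp_integ (C μ * (d⁄dX ℂ u * u⁻¹))
  refine ⟨G, h0, ?_⟩
  rw [h]
  linear_combination (C μ * d⁄dX ℂ u * G) * PowerSeries.mul_inv_cancel u hu

/-- The logarithmic correction `X ^ p G₂ L`, with `L' = κ u' / u`, replaces the factor `u` by `θ' =
u + X u'`, as `Θ(b) = b θ'(a)` requires. -/
theorem series_identity {u G₂ L : PowerSeries ℂ} {l₀ κ : ℂ} {p : ℕ} (hp : 1 ≤ p)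
    (hG : u * d⁄dX ℂ G₂ = C (l₀ + p - 1) * (d⁄dX ℂ u * G₂))
    (hL : u * d⁄dX ℂ L = C κ * d⁄dX ℂ u) :
    C κ * (u * G₂ * X ^ p) + (C l₀ * (u * (X ^ p * G₂ * L)) +
      X * d⁄dX ℂ (u * (X ^ p * G₂ * L)) - C (l₀ + p) * (d⁄dX ℂ (X * u) * (X ^ p * G₂ * L))) =
    C κ * (d⁄dX ℂ (X * u) * X ^ p * G₂) := by
  obtain ⟨m, rfl⟩ : ∃ m, p = m + 1 := ⟨p - 1, by omega⟩
  simp only [Derivation.leibniz, Derivation.leibniz_pow, derivative_X, smul_eq_mul, map_add,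
    map_sub, map_one, map_natCast, nsmul_eq_mul, add_tsub_cancel_right] at hG hL ⊢
  push_cast at hG ⊢
  linear_combination (X ^ (m + 2) * L) * hG + (X ^ (m + 2) * G₂) * hL

/-- The transformed pair is `ε' = G₀ ε` and `e' = U e`, satisfying the defining relations after `Θ`
with `c χ ^ (-p)` in place of `c`. The nonvanishing of the `l₁ - 1 + j` allows `b ^ p` to be traded
for `a ^ p` on `ε`. -/
theorem star_relation {l₁ l₂ : ℂ} {p : ℕ} (hp : 1 ≤ p) (hl : (p : ℂ) = l₂ - l₁ + 1)
    (hD : ∀ j : ℕ, l₁ - 1 + j ≠ 0) (c : ℂ) {u : PowerSeries ℂ} (hu : t.θ = X * u)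
    (hu0 : constantCoeff u = t.chi)
    {E : Type*} [AddCommGroup E] [Module AHat E] {ε e : E} (hε0 : aSub (l₁ - 1) • ε = 0)
    (he0 : aSub l₂ • e = ofB (X * (1 + C c * X ^ p)) • ε) :
    ∃ U : AHat, constantCoeff (modB U) ≠ 0 ∧
      (t.Theta (presentation l₁ l₂ (1 + C (c * t.chi⁻¹ ^ p) * X ^ p)) * U) • e = 0 := by
  have hchi : t.chi ≠ 0 := t.coeff_one_ne
  have hun : constantCoeff u ≠ 0 := hu0 ▸ hchi
  have hp0 : p ≠ 0 := by omega
  have hpC : (p : ℂ) ≠ 0 := Nat.cast_ne_zero.2 hp0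
  have hl₂ : l₂ = l₁ - 1 + p := by rw [hl]; ring
  obtain ⟨S, hS⟩ : ∃ S : PowerSeries ℂ, S = 1 + C c * X ^ p := ⟨_, rfl⟩
  have hS0 : constantCoeff S ≠ 0 := by simp [hS, hp0]
  obtain ⟨c', hc'⟩ : ∃ c', c' = c * t.chi⁻¹ ^ p := ⟨_, rfl⟩
  obtain ⟨S', hS'⟩ : ∃ S' : PowerSeries ℂ, S' = 1 + C c' * X ^ p := ⟨_, rfl⟩
  have hS'0 : constantCoeff S' ≠ 0 := by simp [hS', hp0]
  rw [← hS] at he0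
  rw [← hc', ← hS']
  obtain ⟨D, hDdef⟩ : ∃ D, D = ∏ j ∈ Finset.range p, (l₁ - 1 + (j : ℂ)) := ⟨_, rfl⟩
  have hD0 : D ≠ 0 := hDdef ▸ Finset.prod_ne_zero_iff.2 fun j _ => hD j
  obtain ⟨q, hq⟩ := exists_a_pow_eq (l₁ - 1) p
  rw [← hDdef] at hq
  have hbp : b ^ p = D⁻¹ • (a ^ p - q * aSub (l₁ - 1)) := by
    rw [hq, add_sub_cancel_right, smul_smul, inv_mul_cancel₀ hD0, one_smul]
  -- `G₀`, `G₂` are `(u / χ) ^ (l₁ - 2)` and `(u / χ) ^ (l₂ - 1)`; below, `L` is `c / D` times `log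
  -- (u / χ)`.
  obtain ⟨G₀, hG₀0, hG₀⟩ := exists_power hun (l₁ - 1 - 1)
  obtain ⟨G₂, hG₂def⟩ : ∃ G₂, G₂ = C (t.chi⁻¹ ^ p) * u ^ p * G₀ := ⟨_, rfl⟩
  have hG₂0 : constantCoeff G₂ = 1 := by
    simp [hG₂def, hG₀0, hu0, hchi]
  have hG₂ : u * d⁄dX ℂ G₂ = C (l₁ - 1 + p - 1) * (d⁄dX ℂ u * G₂) := by
    obtain ⟨m, rfl⟩ : ∃ m, p = m + 1 := ⟨p - 1, by omega⟩
    rw [hG₂def]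
    simp only [Derivation.leibniz, Derivation.leibniz_pow, derivative_C, smul_eq_mul, map_add,
      map_sub, map_one, map_natCast, nsmul_eq_mul, add_tsub_cancel_right] at hG₀ ⊢
    push_cast
    linear_combination (C (t.chi⁻¹ ^ (m + 1)) * u ^ (m + 1)) * hG₀
  obtain ⟨L, hLdef⟩ : ∃ L, L = integ (C (c * D⁻¹) * (d⁄dX ℂ u * u⁻¹)) := ⟨_, rfl⟩
  have hL : u * d⁄dX ℂ L = C (c * D⁻¹) * d⁄dX ℂ u := by
    rw [hLdef, deriv_integ]
    linear_combination (C (c * D⁻¹) * d⁄dX ℂ u) * PowerSeries.mul_inv_cancel u hun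
  obtain ⟨H, hH⟩ : ∃ H, H = X ^ p * G₂ * L := ⟨_, rfl⟩
  have hid := series_identity hp hG₂ hL
  rw [← hH, ← hl₂] at hid
  have hbε : b • ε = (ofB S⁻¹ * aSub l₂) • e := by
    rw [mul_smul, he0, smul_smul, ← map_mul,
      show S⁻¹ * (X * S) = X * (S⁻¹ * S) by ring, PowerSeries.inv_mul_cancel _ hS0, mul_one, ofB_X]
  have hA : aSub l₂ = aSub (l₁ - 1) - (p : ℂ) • b := by
    rw [aSub_add_smul l₂ (l₁ - 1), hl₂, sub_add_cancel_left, neg_smul, ← sub_eq_add_neg]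
  have hXS : ∀ c : ℂ, ofB (X * (1 + C c * X ^ p)) = b + c • (b * b ^ p) := by
    intro c
    rw [← smul_eq_C_mul, map_mul, map_add, ofB_smul, map_pow, ofB_X, map_one, mul_add, mul_one,
      mul_smul_comm]
  have hε' : (t.Theta (aSub (l₁ - 1)) * ofA G₀) • ε = 0 := by
    rw [t.Theta_aSub_mul_ofA hu hG₀, mul_smul, hε0, smul_zero]
  -- Since `(a - l₂ b) ε = -p b ε`, adding `ε / p` removes the term `b ε` and leaves the purely
  -- logarithmic part.
  have hη : aSub l₂ • (e + algebraMap ℂ AHat (p : ℂ)⁻¹ • ε) = (c • (b * b ^ p)) • ε := by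
    have h1 : aSub l₂ * algebraMap ℂ AHat (p : ℂ)⁻¹ = (p : ℂ)⁻¹ • aSub (l₁ - 1) - b := by
      rw [← Algebra.commutes, ← Algebra.smul_def, hA, smul_sub, smul_smul, inv_mul_cancel₀ hpC,
        one_smul]
    have h2 : ((p : ℂ)⁻¹ • aSub (l₁ - 1)) • ε = 0 := by
      rw [Algebra.smul_def, mul_smul, hε0, smul_zero]
    rw [smul_add, he0, hS, hXS, smul_smul, h1, sub_smul, h2, add_smul]
    abel
  have hbpε : (b ^ p) • ε = (D⁻¹ • a ^ p) • ε := by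
    have : (D⁻¹ • (q * aSub (l₁ - 1))) • ε = 0 := by
      rw [← smul_mul_assoc, mul_smul, hε0, smul_zero]
    rw [hbp, smul_sub, sub_smul, this, sub_zero]
  have hηΘ : (t.Theta (aSub l₂) * ofA G₂) • (e + algebraMap ℂ AHat (p : ℂ)⁻¹ • ε) =
      (b * ofA (C (c * D⁻¹) * (u * G₂ * X ^ p))) • ε := by
    have hG₂' : u * d⁄dX ℂ G₂ = C (l₂ - 1) * (d⁄dX ℂ u * G₂) := by rw [hG₂, hl₂]
    rw [t.Theta_aSub_mul_ofA hu hG₂', mul_smul, hη, smul_smul, mul_smul_comm, ← mul_assoc,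
      ofA_sub_mul_b, ← smul_mul_assoc, mul_smul, hbpε, smul_smul, smul_mul_assoc, mul_smul_comm,
      smul_smul, a, ← map_pow, mul_assoc, ← map_mul, ← mul_smul_comm, ← ofA_smul, smul_eq_C_mul]
  have hHΘ : (t.Theta (aSub l₂) * ofA H) • ε = (b * ofA (C (l₁ - 1) * (u * H) +
      X * d⁄dX ℂ (u * H) - C l₂ * (d⁄dX ℂ (X * u) * H))) • ε := by
    rw [Theta_aSub, sub_mul, ← map_mul, sub_smul, hu, mul_assoc X, ofA_X_mul_smul hε0, ← sub_smul,
      smul_mul_assoc, mul_assoc b, ← map_mul, ← mul_smul_comm, ← ofA_smul, smul_eq_C_mul, ← mul_sub,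
      ← map_sub]
  have hbε' : (t.Theta (b * b ^ p) * ofA G₀) • ε =
      (b * ofA (C D⁻¹ * (d⁄dX ℂ (X * u) * (X * u) ^ p * G₀))) • ε := by
    have h1 : (D⁻¹ • (t.Theta q * (t.Theta (aSub (l₁ - 1)) * ofA G₀))) • ε = 0 := by
      rw [← smul_mul_assoc, mul_smul, hε', smul_zero]
    rw [map_mul, hbp, Theta_smul, map_sub, map_pow, map_mul, Theta_a, Theta_b, ← hu, ← map_pow,
      mul_assoc _ _ (ofA G₀), smul_mul_assoc, sub_mul, mul_assoc (t.Theta q), smul_sub, mul_sub,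
      sub_smul, mul_smul _ (D⁻¹ • (t.Theta q * (t.Theta (aSub (l₁ - 1)) * ofA G₀))), h1, smul_zero,
      sub_zero, mul_assoc b, ← map_mul, ← ofA_smul, ← map_mul, smul_eq_C_mul]
    congr 3
    ring
  -- The weight appears here: `u ^ p G₀ = χ ^ p G₂`, so `c' χ ^ p = c`.
  have hfinal : (C (c * D⁻¹) * (d⁄dX ℂ (X * u) * X ^ p * G₂) : PowerSeries ℂ) =
      C c' * (C D⁻¹ * (d⁄dX ℂ (X * u) * (X * u) ^ p * G₀)) := by
    rw [hG₂def, hc', map_mul C c, map_mul C c]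
    ring
  -- Transform of `e`: the logarithmic part with its correction `H ε`, minus `ε' / p`, which
  -- restores the term `b ε'`.
  obtain ⟨e', he'⟩ : ∃ e', e' = ofA G₂ • (e + algebraMap ℂ AHat (p : ℂ)⁻¹ • ε) + ofA H • ε -
    (algebraMap ℂ AHat (p : ℂ)⁻¹ * ofA G₀) • ε := ⟨_, rfl⟩
  have hmain : t.Theta (aSub l₂) • e' = t.Theta (ofB (X * S')) • ofA G₀ • ε := by
    have h1 : t.Theta (aSub l₂) * (algebraMap ℂ AHat (p : ℂ)⁻¹ * ofA G₀) =
        (p : ℂ)⁻¹ • (t.Theta (aSub (l₁ - 1)) * ofA G₀) - t.Theta b * ofA G₀ := by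
      rw [← mul_assoc, ← Algebra.commutes, mul_assoc, ← Algebra.smul_def, hA, map_sub, Theta_smul,
        sub_mul, smul_sub, smul_mul_assoc, smul_smul, inv_mul_cancel₀ hpC, one_smul]
    have h2 : ((p : ℂ)⁻¹ • (t.Theta (aSub (l₁ - 1)) * ofA G₀)) • ε = 0 := by
      rw [Algebra.smul_def, mul_smul, hε', smul_zero]
    rw [he', smul_sub, smul_add, smul_smul, smul_smul, smul_smul, hηΘ, hHΘ, ← add_smul, ← mul_add,
      ← map_add, hid, hfinal, h1, sub_smul, h2, zero_sub, sub_neg_eq_add, hS', hXS, map_add,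
      add_smul, Theta_smul, smul_smul, smul_smul, smul_mul_assoc, Algebra.smul_def c', mul_smul
      (algebraMap ℂ AHat c'), hbε', smul_smul, ← Algebra.smul_def, ← mul_smul_comm, ← ofA_smul,
      smul_eq_C_mul]
    abel
  -- The total coefficient of `ε` in `e'` has no constant term. Since `a ε = (l₁ - 1) b ε` lies in
  -- `Â e`, so does `e'`.
  obtain ⟨w, hw⟩ : ∃ w, C (p : ℂ)⁻¹ * (G₂ - G₀) + H = X * w := by
    apply X_dvd_iff.2
    simp [hG₂0, hG₀0, hH, hp0]
  have hUe : (ofA G₂ + (l₁ - 1) • (ofA w * (ofB S⁻¹ * aSub l₂))) • e = e' := by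
    have h1 : ofA (X * w) • ε = ((l₁ - 1) • (ofA w * (ofB S⁻¹ * aSub l₂))) • e := by
      have h : ofA (X * w) = ofA w * aSub (l₁ - 1) + (l₁ - 1) • ofA w * b := by
        rw [aSub_eq, mul_sub, mul_smul_comm, smul_mul_assoc, mul_comm X, map_mul, a, sub_add_cancel]
      rw [h, add_smul, mul_smul, hε0, smul_zero, zero_add, mul_smul, hbε, smul_smul, smul_mul_assoc]
    rw [add_smul, ← h1, ← hw, he', ← smul_eq_C_mul, map_add, ofA_smul, map_sub, smul_sub, smul_add,
      smul_smul, ← Algebra.commutes, ← Algebra.smul_def, ← Algebra.smul_def, add_smul, sub_smul]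
    abel
  refine ⟨ofA G₂ + (l₁ - 1) • (ofA w * (ofB S⁻¹ * aSub l₂)), ?_, ?_⟩
  · simp [Algebra.smul_def, algebraMap_eq_ofA, modB_ofA, modB_aSub, hG₂0]
  · have h1 : S'⁻¹ * (X * S') = X := by
      rw [mul_left_comm, PowerSeries.inv_mul_cancel _ hS'0, mul_one]
    rw [mul_smul, hUe, presentation, map_mul, mul_smul, hmain, ← mul_smul, ← map_mul, mul_assoc,
      ← map_mul, h1, ofB_X, aSub_mul_b, map_mul, mul_smul, ← mul_smul _ (ofA G₀), hε', smul_zero]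

theorem star_isoClass {lam₁ lam₂ : ℚ} {p : ℕ} (hlam : 1 < lam₁) (hp : 1 ≤ p)
    (hl : (p : ℂ) = (lam₂ : ℂ) - lam₁ + 1) (c : ℂ) :
    t.star (isoClass (presented lam₁ lam₂ (1 + C c * X ^ p))) =
      isoClass (presented lam₁ lam₂ (1 + C (c * t.chi⁻¹ ^ p) * X ^ p)) := by
  have hp0 : p ≠ 0 := by omega
  -- Here `λ₁ > 1` excludes the zero factors of `D`.
  have hD : ∀ j : ℕ, (lam₁ : ℂ) - 1 + j ≠ 0 := by
    intro j h
    have h' : lam₁ - 1 + (j : ℚ) = 0 := by exact_mod_cast h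
    have : (0 : ℚ) ≤ j := j.cast_nonneg
    linarith
  obtain ⟨u, hu, hu0⟩ := t.exists_eq_X_mul
  have hun : constantCoeff u ≠ 0 := hu0 ▸ t.coeff_one_ne
  obtain ⟨U, hU, h⟩ := t.star_relation hp hl hD c hu hu0 (SatModule.aSub_smul_eps _ _ _)
    (SatModule.aSub_smul_gen _ _ _)
  -- Modulo `b`, `Θ` of the presentation is `θ ^ 2 = u ^ 2 X ^ 2`.
  obtain ⟨V, hV, hVU⟩ := eq_unit_mul (by simp [hp0]) (v := ofA (u ^ 2)) (by
    rw [modB_Theta, modB_presentation _ _ _ (by simp [hp0]), subst_pow t.hasSubst,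
      subst_X t.hasSubst, modB_ofA, hu]
    ring) (by simp [modB_ofA, hun]) hU h
  have hUu := isUnit_of_constantCoeff U hU
  change isoClass ((ModuleCat.restrictScalars t.Theta).obj _) = _
  rw [eq_comm, isoClass_eq_iff]
  exact nonempty_equiv_of_generator
    (E := (ModuleCat.restrictScalars t.Theta).obj (presented lam₁ lam₂ (1 + C c * X ^ p)))
    (U • cyclicGen (Submodule.span AHat {presentation lam₁ lam₂ (1 + C c * X ^ p)}))
    (exists_smul_unit_cyclicGen t.Theta_bijective hUu)
    (smul_unit_cyclicGen_eq_zero t.Theta_bijective hUu hV hVU)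

end ChangeOfVariable

/-! ### The proposition -/

theorem mainTheorem10 (lam₁ lam₂ : ℚ) (p : ℕ) (hlam : 1 < lam₁) (hp : 1 ≤ p)
    (hp_eq : (p : ℚ) = lam₂ - lam₁ + 1) :
    (∀ S : PowerSeries ℂ, PowerSeries.constantCoeff S = 1 →
      AHat.isoClass (AHat.presented lam₁ lam₂ S) ∈ AHat.frescoClasses lam₁ lam₂) ∧
    (∀ x ∈ AHat.frescoClasses lam₁ lam₂, ∃ S ∈ AHat.versalBase p,
      AHat.isoClass (AHat.presented lam₁ lam₂ S) = x) ∧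
    ∃ α : AHat.frescoClasses lam₁ lam₂ → ℂ,
      (∀ S : PowerSeries ℂ, PowerSeries.constantCoeff S = 1 →
        ∀ x : AHat.frescoClasses lam₁ lam₂,
          AHat.isoClass (AHat.presented lam₁ lam₂ S) = x.1 → α x = PowerSeries.coeff p S) ∧
      AHat.IsPolynomialParameter lam₁ lam₂ p α ∧
      IsQuasiInvariant (AHat.frescoClasses lam₁ lam₂) α p := by
  have hpC : (p : ℂ) = (lam₂ : ℂ) - lam₁ + 1 := by exact_mod_cast hp_eq
  have hp0 : p ≠ 0 := by omega
  have hle : lam₁ ≤ lam₂ := by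
    have : (1 : ℚ) ≤ p := by exact_mod_cast hp
    linarith
  have hmem : ∀ S : PowerSeries ℂ, PowerSeries.constantCoeff S = 1 →
      AHat.isoClass (AHat.presented lam₁ lam₂ S) ∈ AHat.frescoClasses lam₁ lam₂ :=
    fun S hS => AHat.presented_mem_frescoClasses hlam hle (by simp [hS])
  have hnormal : ∀ x ∈ AHat.frescoClasses lam₁ lam₂, ∃ c : ℂ, AHat.isoClass
      (AHat.presented lam₁ lam₂ (1 + PowerSeries.C c * PowerSeries.X ^ p)) = x := by
    rintro _ ⟨E, rfl, ⟨-, hE⟩, hinv⟩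
    obtain ⟨S, hS, ⟨f⟩⟩ := AHat.exists_equiv_presented hinv hE
    obtain ⟨g⟩ := AHat.equiv_presented_one_add hp hpC hS
    exact ⟨_, (AHat.isoClass_eq_iff _ _).2 ⟨g.trans f⟩⟩
  have hone : ∀ c : ℂ, PowerSeries.constantCoeff
      (1 + PowerSeries.C c * PowerSeries.X ^ p : PowerSeries ℂ) = 1 := fun c => by simp [hp0]
  have hcoeff : ∀ c : ℂ, PowerSeries.coeff p
      (1 + PowerSeries.C c * PowerSeries.X ^ p : PowerSeries ℂ) = c := fun c => by
    simp [PowerSeries.coeff_one, hp0]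
  -- An arbitrary choice of normal form; `coeff_eq_of_equiv` makes it independent of the choice.
  choose α hα using fun x : AHat.frescoClasses lam₁ lam₂ => hnormal x.1 x.2
  have hαcoeff : ∀ S : PowerSeries ℂ, PowerSeries.constantCoeff S = 1 →
      ∀ x : AHat.frescoClasses lam₁ lam₂,
        AHat.isoClass (AHat.presented lam₁ lam₂ S) = x.1 → α x = PowerSeries.coeff p S := by
    intro S hS x hx
    obtain ⟨f⟩ := (AHat.isoClass_eq_iff _ _).1 (hx.trans (hα x).symm)
    rw [← hcoeff (α x)]
    exact AHat.coeff_eq_of_equiv hp hpC (hone _) hS f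
  have hstar : ∀ (t : ChangeOfVariable) (x : AHat.frescoClasses lam₁ lam₂), t.star x.1 =
      AHat.isoClass (AHat.presented lam₁ lam₂
        (1 + PowerSeries.C (α x * t.chi⁻¹ ^ p) * PowerSeries.X ^ p)) := by
    intro t x
    rw [← t.star_isoClass hlam hp hpC, hα]
  refine ⟨hmem, fun x hx => ?_, α, hαcoeff, ⟨MvPolynomial.X p, fun S hS x hx => ?_⟩,
    fun t x hx => ?_, fun t x => ?_⟩
  · obtain ⟨c, hc⟩ := hnormal x hx
    refine ⟨_, ⟨hone c, ?_⟩, hc⟩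
    rw [Submodule.mem_span_pair]
    exact ⟨1, c, by rw [one_smul, PowerSeries.smul_eq_C_mul]⟩
  · rw [MvPolynomial.eval_X, hαcoeff S hS.1 x hx]
  · rw [hstar t ⟨x, hx⟩]
    exact hmem _ (hone _)
  · rw [hαcoeff _ (hone _) ⟨t.star x.1, _⟩ (hstar t x).symm, hcoeff, mul_left_comm, ← mul_pow,
      mul_inv_cancel₀ (show t.chi ≠ 0 from t.coeff_one_ne), one_pow, mul_one]
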